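/- **Setting.** Let $n,m,d\ge 0$ and $k\ge1$ be integers, $T>0$, $r>0$, $0\le\tau\le\min\{r,T\}$, $\epsilon>0$, $\varepsilon_k\ge0$, $\widetilde\mu\in\mathbb R$, $h=T/k$, $t_j=jh$. Let $x^*_1,\dots,x^*_m\in\mathbb R^n$, $C=\{x:\langle x^*_i,x\rangle\le0\ \forall i\}$, let $f:\mathbb R^n\times\mathbb R^d\to\mathbb R^n$ be continuous, and put $F(x,u,a)=N(x-u;C)+f(x,a)$, where $N(\cdot\,;C)$ is the normal cone of convex analysis (empty outside $C$). Let $\varphi:\mathbb R^n\to(-\infty,\infty]$ and $\ell:\mathbb R\times(\mathbb R^{2n+d})^2\to(-\infty,\infty]$, and let $\bar z=(\bar x,\bar u,\bar a)$ be a $W^{1,2}$ arc on $[0,T]$ whose component $\bar x$ has a right derivative $\dot{\bar x}(0)$. All norms are Euclidean. Call $j\in\{0,\dots,k\}$ a middle node if $\tau\le t_j\le T-\tau$. **Problem $(P^\tau_k)$.** Write $z_j=(x_j,u_j,a_j)$, $0\le j\le k$, and $Z_j=(X_j,U_j,A_j)=(z_{j+1}-z_j)/h$, $0\le j\le k-1$;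 put $G(z)=\sum_{j=0}^{k-1}\int_{t_j}^{t_{j+1}}\|Z_j-\dot{\bar z}(t)\|^2dt$ and $V(z)=\sum_{j=0}^{k-2}\big\|\tfrac{u_{j+2}-2u_{j+1}+u_j}{h}\big\|$. Minimize $$\varphi(x_k)+h\sum_{j=0}^{k-1}\ell(t_j,z_j,Z_j)+\|X_0-\dot{\bar x}(0)\|^2+G(z)+\mathrm{dist}^2\big(\|U_0\|;(-\infty,\widetilde\mu]\big)+\mathrm{dist}^2\big(V(z);(-\infty,\widetilde\mu]\big)$$ subject to: $z_0=\bar z(0)$; $x_{j+1}\in x_j-hF(z_j)$ for $0\le j\le k-1$; $\langle x^*_i,x_k-u_k\rangle\le0$ for all $i$; $\|u_j\|=r$ at middle nodes and $r-\tau-\varepsilon_k\le\|u_j\|\le r+\tau+\varepsilon_k$ at the other nodes $0\le j\le k$; $\|z_j-\bar z(t_j)\|\le\epsilon/2$ for $0\le j\le k-1$; $G(z)\le\epsilon/2$; $\|U_0\|\le\widetilde\mu+1$; $V(z)\le\widetilde\mu+1$. **Limiting constructions.** For $\Omega$ in a Euclidean space and $\bar y\in\Omega$, $N(\bar y;\Omega)$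 is the set of all limits of sequences $c_i(y_i-w_i)$ with $y_i\to\bar y$, $c_i\ge0$ and $w_i$ a nearest point to $y_i$ in $\Omega$. Where $\psi$ is finite, $\partial\psi(\bar y)=\{v:(v,-1)\in N((\bar y,\psi(\bar y));\mathrm{epi}\,\psi)\}$. Below, $\partial\ell$ is taken in $(z,Z)$ at fixed $t_j$. **Theorem.** Let $z=(z_0,\dots,z_k)$ be an optimal solution of $(P^\tau_k)$ such that $\varphi$ is finite and Lipschitz continuous around $x_k$ and each $\ell(t_j,\cdot,\cdot)$, $0\le j\le k-1$, is finite and Lipschitz continuous around $(z_j,Z_j)$. Suppose that the localization constraints are inactive and the variation penalties vanish at $z$: $\|z_j-\bar z(t_j)\|<\epsilon/2$ for $0\le j\le k-1$, $G(z)<\epsilon/2$, $\|U_0\|\le\widetilde\mu$, $V(z)\le\widetilde\mu$. Put $$\theta_j=(\theta^x_j,\theta^u_j,\theta^a_j)=2\int_{t_j}^{t_{j+1}}\big(Z_j-\dot{\bar z}(t)\big)\,dt,\qquad \chi_1=\tfrac{2}{h^2}\big(X_0-\dot{\bar x}(0)\big),\qquad \chi_j=0\ (j\ne1).$$ Then there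 exist $\lambda\ge0$, $\alpha\in\mathbb R^m_+$, $\xi=(\xi_0,\dots,\xi_k)\in\mathbb R^{k+1}$, $p_j=(p^x_j,p^u_j,p^a_j)\in\mathbb R^{2n+d}$ for $0\le j\le k$, and $(w_j,v_j)=(w^x_j,w^u_j,w^a_j,v^x_j,v^u_j,v^a_j)\in\partial\ell(t_j,z_j,Z_j)$ for $0\le j\le k-1$, such that 1. $\lambda+\|\alpha\|+\|\xi\|+\sum_{j=0}^{k-1}\|p^x_j\|+\|p^u_0\|+\|p^a_0\|\ne0$; 2. $\alpha_i\langle x^*_i,x_k-u_k\rangle=0$ for all $i$; 3. $\xi_j(\nu-\|u_j\|)\le0$ for all $\nu\in[r-\tau-\varepsilon_k,r+\tau+\varepsilon_k]$ and every $0\le j\le k$ that is not a middle node; 4. $-p^x_k\in\lambda\big(\partial\varphi(x_k)+h\chi_k\big)+\sum_i\alpha_ix^*_i$ (where $\chi_k=0$ unless $k=1$), $p^u_k=\sum_i\alpha_ix^*_i-2\xi_ku_k$, and $p^a_k=0$; 5. $p^u_{j+1}=\lambda(v^u_j+h^{-1}\theta^u_j)$ and $p^a_{j+1}=\lambda(v^a_j+h^{-1}\theta^a_j)$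 for $0\le j\le k-1$; 6. for all $0\le j\le k-1$, $$\Big(\tfrac{p^x_{j+1}-p^x_j}{h}-\lambda w^x_j-\lambda\chi_j,\ \tfrac{p^u_{j+1}-p^u_j}{h}-\lambda w^u_j,\ \tfrac{p^a_{j+1}-p^a_j}{h}-\lambda w^a_j,\ \lambda(v^x_j+h^{-1}\theta^x_j)-p^x_{j+1}\Big)$$ $$\in\Big(0,\tfrac2h\xi_ju_j,0,0\Big)+N\Big(\big(x_j,u_j,a_j,-X_j\big);\mathrm{gph}\,F\Big).$$ -/

import Mathlib

namespace SweepingControl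

open scoped RealInnerProductSpace

/-- The Euclidean space `ℝⁿ`. -/
abbrev Vec (n : ℕ) := EuclideanSpace ℝ (Fin n)

/-- The product of two Euclidean spaces with its Euclidean norm. -/
abbrev EProd (A B : Type) := WithLp 2 (A × B)

/-- The element `(a, b)` of the Euclidean product. -/
def pair {A B : Type} (a : A) (b : B) : EProd A B := WithLp.toLp 2 (a, b)

/-- The space of triples `z = (x, u, a)` in `ℝⁿ × ℝⁿ × ℝᵈ` with the Euclidean norm. -/
abbrev State (n d : ℕ) := EProd (Vec n) (EProd (Vec n) (Vec d))

variable {n m d : ℕ}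

/-- The triple `(x, u, a)`. -/
def triple (x u : Vec n) (a : Vec d) : State n d := pair x (pair u a)

/-- The `x`-component of `z = (x, u, a)`. -/
def xc (z : State n d) : Vec n := z.fst

/-- The `u`-component of `z = (x, u, a)`. -/
def uc (z : State n d) : Vec n := z.snd.fst

/-- The `a`-component of `z = (x, u, a)`. -/
def ac (z : State n d) : Vec d := z.snd.snd

section GeneralizedDifferentiation

variable {E : Type} [NormedAddCommGroup E] [InnerProductSpace ℝ E]

/-- The Euclidean projection of `x` onto `Ω`: the set of all points of `Ω` nearest to `x`. -/
def proj (x : E) (Ω : Set E) : Set E :=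
  {w | w ∈ Ω ∧ ∀ y ∈ Ω, ‖x - w‖ ≤ ‖x - y‖}

/-- The (Mordukhovich) limiting normal cone to `Ω` at a point `xb` of `Ω`: the outer limit, as
`x → xb`, of the cones generated by `x - proj x Ω`. -/
def limitingNormalCone (xb : E) (Ω : Set E) : Set E :=
  {v | xb ∈ Ω ∧ ∃ (x : ℕ → E) (y : ℕ → E),
    Filter.Tendsto x Filter.atTop (nhds xb) ∧
    Filter.Tendsto y Filter.atTop (nhds v) ∧
    ∀ i, ∃ c : ℝ, 0 ≤ c ∧ ∃ w ∈ proj (x i) Ω, y i = c • (x i - w)}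

/-- The epigraph of an extended-real-valued function. -/
def epi (φ : E → EReal) : Set (EProd E ℝ) :=
  {q | φ q.fst ≤ (q.snd : EReal)}

/-- The limiting subdifferential of `φ` at `xb`: all `v` such that `(v, -1)` is a limiting normal
to the epigraph at `(xb, φ xb)`; it is empty where `φ` is not finite. -/
def subdiff (φ : E → EReal) (xb : E) : Set E :=
  {v | ∃ s : ℝ, φ xb = (s : EReal) ∧ pair v (-1 : ℝ) ∈ limitingNormalCone (pair xb s) (epi φ)}

/-- `φ` is finite and Lipschitz continuous on some neighbourhood of `xb`. -/
def LocallyLipschitzAround (φ : E → EReal) (xb : E) : Prop :=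
  ∃ (g : E → ℝ) (K : NNReal), ∃ U ∈ nhds xb,
    LipschitzOnWith K g U ∧ ∀ y ∈ U, φ y = ((g y : ℝ) : EReal)

open Classical in
/-- The normal cone of convex analysis to a convex set, empty at points outside of the set. -/
noncomputable def convexNormalCone (x : E) (C : Set E) : Set E :=
  if x ∈ C then {v | ∀ y ∈ C, ⟪v, y - x⟫ ≤ 0} else ∅

/-- The graph of a set-valued mapping. -/
def gph {A B : Type} (F : A → Set B) : Set (EProd A B) := {q | q.snd ∈ F q.fst}

end GeneralizedDifferentiation

/-- The data of the discrete sweeping control problem: the generators `gen i` of the polyhedral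
cone `C`, the perturbation `f`, the terminal cost `φ`, the running cost `ℓ t (z, z')`, the final
time `T`, the radius `r`, the parameter `τ`, the reference arc `zbar = (x, u, a)` on `[0, T]`, the
number `k` of mesh intervals, the radius `ε` of localization around the reference arc, the
perturbation `εk` of the norm constraints, and the variation bound `μ`. -/
structure Data (n m d : ℕ) where
  gen : Fin m → Vec n
  f : Vec n → Vec d → Vec n
  φ : Vec n → EReal
  ℓ : ℝ → EProd (State n d) (State n d) → EReal
  T : ℝ
  r : ℝ
  τ : ℝ
  zbar : ℝ → State n d
  k : ℕ
  ε : ℝ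
  εk : ℝ
  μ : ℝ

namespace Data

variable (P : Data n m d)

/-- The polyhedron `C = {x | ⟨gen i, x⟩ ≤ 0 for all i}`. -/
def C : Set (Vec n) := {x | ∀ i, ⟪P.gen i, x⟫ ≤ 0}

/-- The sweeping mapping `F(x, u, a) = N(x - u; C) + f(x, a)`. -/
def F (z : State n d) : Set (Vec n) :=
  {w | ∃ v ∈ convexNormalCone (xc z - uc z) P.C, w = v + P.f (xc z) (ac z)}

/-- The step size `T / k` of the uniform mesh. -/
noncomputable def h : ℝ := P.T / P.k

/-- The mesh point `t_j = j h`. -/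
noncomputable def t (j : ℕ) : ℝ := j * P.h

/-- The nodes `j` with `τ ≤ t_j ≤ T - τ`, that is, those from the smallest `j` with `t_j ≥ τ` up to
the largest `j` with `t_j ≤ T - τ`. -/
def MiddleNode (j : ℕ) : Prop := P.τ ≤ P.t j ∧ P.t j ≤ P.T - P.τ

/-- The discrete velocity `(z_{j+1} - z_j) / h`. -/
noncomputable def vel (z : ℕ → State n d) (j : ℕ) : State n d := P.h⁻¹ • (z (j + 1) - z j)

/-- The right derivative at `0` of the `x`-component of the reference arc. -/
noncomputable def xdot0 : Vec n := derivWithin (fun s => xc (P.zbar s)) (Set.Ici 0) 0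

/-- The squared `L²` distance between the discrete velocities and the velocity of the reference
arc. -/
noncomputable def velocityGap (z : ℕ → State n d) : ℝ :=
  ∑ j ∈ Finset.range P.k, ∫ s in (P.t j)..(P.t (j + 1)), ‖P.vel z j - deriv P.zbar s‖ ^ 2

/-- The total variation of the discrete velocity of the `u`-component. -/
noncomputable def uVariation (z : ℕ → State n d) : ℝ :=
  ∑ j ∈ Finset.range (P.k - 1),
    ‖P.h⁻¹ • (uc (z (j + 2)) - (2 : ℝ) • uc (z (j + 1)) + uc (z j))‖

/-- The cost functional of the discrete problem. Only the entries `z 0, …, z k` are used. -/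
noncomputable def cost (z : ℕ → State n d) : EReal :=
  P.φ (xc (z P.k))
    + (P.h : EReal) * ∑ j ∈ Finset.range P.k, P.ℓ (P.t j) (pair (z j) (P.vel z j))
    + ((‖xc (P.vel z 0) - P.xdot0‖ ^ 2 + P.velocityGap z
        + Metric.infDist ‖uc (P.vel z 0)‖ (Set.Iic P.μ) ^ 2
        + Metric.infDist (P.uVariation z) (Set.Iic P.μ) ^ 2 : ℝ) : EReal)

/-- The constraints of the discrete problem. Only the entries `z 0, …, z k` are used. -/
structure Feasible (z : ℕ → State n d) : Prop where
  initial : z 0 = P.zbar 0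
  dynamics : ∀ j < P.k, ∃ w ∈ P.F (z j), xc (z (j + 1)) = xc (z j) - P.h • w
  terminal : ∀ i, ⟪P.gen i, xc (z P.k) - uc (z P.k)⟫ ≤ 0
  norm_middle : ∀ j ≤ P.k, P.MiddleNode j → ‖uc (z j)‖ = P.r
  norm_end : ∀ j ≤ P.k, ¬ P.MiddleNode j →
    P.r - P.τ - P.εk ≤ ‖uc (z j)‖ ∧ ‖uc (z j)‖ ≤ P.r + P.τ + P.εk
  near : ∀ j < P.k, ‖z j - P.zbar (P.t j)‖ ≤ P.ε / 2
  near_velocity : P.velocityGap z ≤ P.ε / 2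
  u_velocity : ‖uc (P.vel z 0)‖ ≤ P.μ + 1
  u_variation : P.uVariation z ≤ P.μ + 1

/-- Optimal solutions of the discrete problem. -/
def IsOptimal (z : ℕ → State n d) : Prop :=
  P.Feasible z ∧ ∀ y, P.Feasible y → P.cost z ≤ P.cost y

/-- The vectors `θ_j`, twice the integral over `[t_j, t_{j+1}]` of the difference between the
discrete velocity and the velocity of the reference arc. -/
noncomputable def θ (z : ℕ → State n d) (j : ℕ) : State n d :=
  (2 : ℝ) • ∫ s in (P.t j)..(P.t (j + 1)), (P.vel z j - deriv P.zbar s)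

/-- The vectors `χ_j`, coming from the term of the cost that penalizes the initial velocity: `χ_1`
is `1 / h` times the gradient of that term with respect to `x_1`, the others are zero. -/
noncomputable def χ (z : ℕ → State n d) (j : ℕ) : Vec n :=
  if j = 1 then (2 / P.h ^ 2) • (xc (P.vel z 0) - P.xdot0) else 0

end Data

end SweepingControl

open Filter Topology MeasureTheory
open scoped RealInnerProductSpace

/-! Fix node 0 and perturb nodes 1, …, k by `e`; the claim is a multiplier rule at `e = 0` in a
finite-dimensional space. Three reductions make `e = 0` a strict local minimizer of Lipschitz costs
plus a smooth function, under closed constraints (`IsOptimal.eventually_lt`). The localization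
constraints are inactive and drop out for small `e`. The two variation penalties are O(‖e‖²), so a
multiple of `∑ ‖e i‖ ^ 2` replaces them without changing the derivative at 0, and a slightly larger
multiple gives strictness. The constraints on ‖u_j‖ become ‖u_j‖² ∈ [a, b], with a smooth left side.

The multiplier rule `exists_limiting_multipliers` comes from quadratic penalization with independent
copies of the arguments of the costs and constraints. Minimizing in the copy of a cost argument
gives a proximal subgradient, bounded by the Lipschitz constant; minimizing in the copy of a
constraint value gives a projection, hence a proximal normal; minimizing in the original variable
gives stationarity. One normalizes and passes to the limit. Closedness of gph F is what admits the
dynamics, in the form (z_j, -X_j) ∈ gph F.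

Testing stationarity with one-node perturbations (`node_equations_of_stationary`) yields the adjoint
recursion, where p_{j+1} is the coefficient of the velocity Z_j divided by h. The Euler–Lagrange
vector at j is then exactly h⁻¹ times the normal η_j to gph F. If all listed multipliers vanished,
every p_j and so every η_j would vanish, against the normalization. -/

namespace SweepingControl

/-! ### Convergence of quadratic penalization -/

/-- Strict minimizers on a compact set are limits of minimizers of the penalized functions. -/
theorem exists_tendsto_penalized_minimizers {W : Type*} [TopologicalSpace W] [T2Space W]
    {K : Set W} (hK : IsCompact K) {Φ ρ : W → ℝ} (hΦ : ContinuousOn Φ K) (hρ : ContinuousOn ρ K)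
    (hρ0 : ∀ w ∈ K, 0 ≤ ρ w) {w₀ : W} (hw₀ : w₀ ∈ K) (hρw₀ : ρ w₀ = 0)
    (hmin : ∀ w ∈ K, ρ w = 0 → w ≠ w₀ → Φ w₀ < Φ w) :
    ∃ w : ℕ → W, Tendsto w atTop (𝓝 w₀) ∧ ∀ N : ℕ, w N ∈ K ∧
      ∀ w' ∈ K, Φ (w N) + N * ρ (w N) ≤ Φ w' + N * ρ w' := by
  have hex : ∀ N : ℕ, ∃ w ∈ K, IsMinOn (fun w => Φ w + N * ρ w) K w := fun N =>
    hK.exists_isMinOn ⟨w₀, hw₀⟩ (hΦ.add (continuousOn_const.mul hρ))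
  choose w hwK hw using hex
  refine ⟨w, ?_, fun N => ⟨hwK N, fun w' hw' => hw N hw'⟩⟩
  rw [tendsto_nhds]
  intro O hO hwO
  -- If no `t N` were empty, these nested compact sets would share a point; letting `N` grow forces
  -- `ρ = 0` there, and `Φ ≤ Φ w₀` away from `w₀` contradicts strictness.
  set t : ℕ → Set W := fun N => (K \ O) ∩ {w | Φ w + N * ρ w ≤ Φ w₀} with ht
  have hcl : ∀ N, IsClosed (t N) := by
    intro N
    have hc : ContinuousOn (fun w => Φ w + N * ρ w) (K \ O) :=
      (hΦ.add (continuousOn_const.mul hρ)).mono Set.sdiff_subset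
    exact hc.preimage_isClosed_of_isClosed (hK.diff hO).isClosed isClosed_Iic
  have hmono : ∀ N M : ℕ, N ≤ M → t M ⊆ t N := by
    rintro N M hNM x ⟨hx, hx'⟩
    refine ⟨hx, ?_⟩
    change Φ x + M * ρ x ≤ Φ w₀ at hx'
    change Φ x + N * ρ x ≤ Φ w₀
    have := hρ0 x hx.1
    have h2 : (N : ℝ) ≤ M := by exact_mod_cast hNM
    have := mul_le_mul_of_nonneg_right h2 this
    linarith
  have hempty : ∃ N, t N = ∅ := by
    by_contra! hne
    obtain ⟨x, hx⟩ := IsCompact.nonempty_iInter_of_sequence_nonempty_isCompact_isClosed t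
      (fun N => hmono N (N + 1) N.le_succ) hne
      ((hK.diff hO).of_isClosed_subset (hcl 0) fun x hx => hx.1) hcl
    have hx' : ∀ N, x ∈ t N := fun N => Set.mem_iInter.1 hx N
    have hxK := (hx' 0).1.1
    have hρx : ρ x = 0 := by
      by_contra h0
      have hpos : 0 < ρ x := lt_of_le_of_ne (hρ0 x hxK) (Ne.symm h0)
      obtain ⟨N, hN⟩ := exists_nat_gt ((Φ w₀ - Φ x) / ρ x)
      have h1 : Φ x + N * ρ x ≤ Φ w₀ := (hx' N).2
      rw [div_lt_iff₀ hpos] at hN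
      linarith
    have h1 : Φ x + (0 : ℕ) * ρ x ≤ Φ w₀ := (hx' 0).2
    have h2 := hmin x hxK hρx (fun h => (hx' 0).1.2 (h ▸ hwO))
    simp only [Nat.cast_zero, zero_mul, add_zero] at h1
    linarith
  obtain ⟨N, hN⟩ := hempty
  filter_upwards [eventually_ge_atTop N] with M hM
  by_contra hMO
  have : w M ∈ t M := by
    refine ⟨⟨hwK M, hMO⟩, ?_⟩
    have := hw M hw₀
    simp only [Set.mem_ofPred_eq, hρw₀, mul_zero, add_zero] at this ⊢
    exact this
  have := hmono N M hM this
  rw [hN] at this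
  exact this

/-! ### Proximal subgradients, epigraphs and limiting normals -/

section Normals

variable {E : Type} [NormedAddCommGroup E] [InnerProductSpace ℝ E]

/-- `v` is a limit of proximal subgradients of `g` at points converging to `x`. -/
def IsLimitProximalSubgradient (g : E → ℝ) (x v : E) : Prop :=
  ∃ y s : ℕ → E, Tendsto y atTop (𝓝 x) ∧ Tendsto s atTop (𝓝 v) ∧
    ∀ i, ∃ c : ℝ, ∀ᶠ y' in 𝓝 (y i), g (y i) + ⟪s i, y' - y i⟫ - c * ‖y' - y i‖ ^ 2 ≤ g y'

/-- The running costs enter the minimization with weight `h`; this removes the weight from their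
subgradients. -/
theorem IsLimitProximalSubgradient.of_const_mul {g : E → ℝ} {x v : E} {a : ℝ} (ha : 0 < a)
    (h : IsLimitProximalSubgradient (fun y => a * g y) x v) :
    IsLimitProximalSubgradient g x (a⁻¹ • v) := by
  obtain ⟨y, s, hy, hs, h⟩ := h
  refine ⟨y, fun i => a⁻¹ • s i, hy, hs.const_smul _, fun i => ?_⟩
  obtain ⟨c, hc⟩ := h i
  refine ⟨a⁻¹ * c, hc.mono fun y' hy' => ?_⟩
  have := mul_le_mul_of_nonneg_left hy' (inv_pos.2 ha).le
  rw [real_inner_smul_left]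
  calc _ = a⁻¹ * (a * g (y i) + ⟪s i, y' - y i⟫ - c * ‖y' - y i‖ ^ 2) := by field_simp
    _ ≤ _ := this
    _ = g y' := by field_simp

/-- Proximal subgradients give nearest points in the epigraph. -/
theorem exists_mem_proj_epi {φ : E → EReal} {y v : E} {s c ρ : ℝ} (hs : φ y = s) (hρ : 0 < ρ)
    (hφ : ∀ y', ‖y' - y‖ < ρ → ((s + ⟪v, y' - y⟫ - c * ‖y' - y‖ ^ 2 : ℝ) : EReal) ≤ φ y') :
    ∀ᶠ t in 𝓝[>] (0 : ℝ),
      pair y s ∈ proj (pair (y + t • v) (s - t)) (epi φ) := by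
  have h1 : ∀ᶠ t in 𝓝 (0 : ℝ), 2 * t * c < 1 := by
    have : Tendsto (fun t : ℝ => 2 * t * c) (𝓝 0) (𝓝 (2 * 0 * c)) :=
      Continuous.tendsto (by fun_prop) 0
    exact this.eventually_lt_const (by norm_num)
  have h2 : ∀ᶠ t in 𝓝 (0 : ℝ), 2 * t * ‖v‖ < ρ / 2 := by
    have : Tendsto (fun t : ℝ => 2 * t * ‖v‖) (𝓝 0) (𝓝 (2 * 0 * ‖v‖)) :=
      Continuous.tendsto (by fun_prop) 0
    exact this.eventually_lt_const (by simpa using hρ)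
  have h3 : ∀ᶠ t in 𝓝 (0 : ℝ), t ^ 2 < ρ * ρ / 2 := by
    have : Tendsto (fun t : ℝ => t ^ 2) (𝓝 0) (𝓝 (0 ^ 2)) :=
      Continuous.tendsto (by fun_prop) 0
    exact this.eventually_lt_const (by simpa using by positivity)
  filter_upwards [nhdsWithin_le_nhds h1, nhdsWithin_le_nhds h2, nhdsWithin_le_nhds h3,
    self_mem_nhdsWithin] with t ht1 ht2 ht3 ht0
  have ht0 : 0 < t := ht0
  refine ⟨by simp [epi, pair, hs], ?_⟩
  intro q hq
  obtain ⟨y', s', rfl⟩ : ∃ y' s', q = pair y' s' := ⟨q.fst, q.snd, rfl⟩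
  have hq : φ y' ≤ (s' : EReal) := hq
  have hexp : ‖pair (y + t • v) (s - t) - pair y' s'‖ ^ 2
      = ‖pair (y + t • v) (s - t) - pair y s‖ ^ 2
        + (‖y' - y‖ ^ 2 - 2 * t * ⟪v, y' - y⟫ + (s' - s) ^ 2 + 2 * t * (s' - s)) := by
    rw [WithLp.prod_norm_sq_eq_of_L2, WithLp.prod_norm_sq_eq_of_L2]
    simp only [pair, WithLp.sub_fst, WithLp.sub_snd, Real.norm_eq_abs, sq_abs]
    have e1 : y + t • v - y' = t • v - (y' - y) := by abel
    have e2 : y + t • v - y = t • v := by abel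
    change ‖y + t • v - y'‖ ^ 2 + (s - t - s') ^ 2 = ‖y + t • v - y‖ ^ 2 + (s - t - s) ^ 2 + _
    rw [e1, e2, norm_sub_sq_real, real_inner_smul_left]
    ring
  refine le_of_sq_le_sq ?_ (norm_nonneg _)
  rw [hexp]
  suffices 0 ≤ ‖y' - y‖ ^ 2 - 2 * t * ⟪v, y' - y⟫ + (s' - s) ^ 2 + 2 * t * (s' - s) by linarith
  have hsq := sq_nonneg (s' - s)
  -- Near `y` the proximal inequality applies and `2 * t * c < 1` absorbs its quadratic error. Far
  -- from `y` nothing is known of `φ`, but the horizontal terms are at least `ρ ^ 2 / 2`, while the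
  -- vertical ones are at least `-t ^ 2`.
  by_cases hd : ‖y' - y‖ < ρ
  · have := (hφ y' hd).trans hq
    rw [EReal.coe_le_coe_iff] at this
    have h4 : 0 ≤ 2 * t * (s' - (s + ⟪v, y' - y⟫ - c * ‖y' - y‖ ^ 2)) := by
      apply mul_nonneg (by positivity); linarith
    have h5 : 0 ≤ (1 - 2 * t * c) * ‖y' - y‖ ^ 2 := mul_nonneg (by linarith) (sq_nonneg _)
    nlinarith
  · push Not at hd
    have h4 : ⟪v, y' - y⟫ ≤ ‖v‖ * ‖y' - y‖ := real_inner_le_norm _ _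
    have h5 : 2 * t * ⟪v, y' - y⟫ ≤ 2 * t * ‖v‖ * ‖y' - y‖ := by
      rw [mul_assoc _ ‖v‖]; exact mul_le_mul_of_nonneg_left h4 (by positivity)
    have h6 : 2 * t * ‖v‖ * ‖y' - y‖ ≤ ρ / 2 * ‖y' - y‖ :=
      mul_le_mul_of_nonneg_right ht2.le (norm_nonneg _)
    have h7 : ρ * ρ ≤ ρ * ‖y' - y‖ := mul_le_mul_of_nonneg_left hd hρ.le
    have h8 : ρ * ‖y' - y‖ ≤ ‖y' - y‖ ^ 2 := by
      rw [sq]; exact mul_le_mul_of_nonneg_right hd (norm_nonneg _)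
    have h9 : 0 ≤ (s' - s + t) ^ 2 := sq_nonneg _
    nlinarith

/-- A short step `t` from a graph point along `(s i, -1)` keeps that graph point nearest in the
epigraph, so `(s i, -1)` is a proximal normal. Continuity of `g` makes the graph points converge. -/
theorem IsLimitProximalSubgradient.mem_subdiff {φ : E → EReal} {g : E → ℝ} {x v : E}
    {U : Set E} (hU : U ∈ 𝓝 x) (hg : ContinuousOn g U) (hφ : ∀ y ∈ U, φ y = (g y : EReal))
    (h : IsLimitProximalSubgradient g x v) : v ∈ subdiff φ x := by
  obtain ⟨y, s, hy, hs, h⟩ := h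
  obtain ⟨N, hN⟩ := eventually_atTop.1 (hy.eventually (eventually_mem_nhds_iff.2 hU))
  -- The bound `1 / (i + 1)` on the step makes the displaced points converge to the same limit as
  -- the graph points.
  have hstep : ∀ i : ℕ, ∃ t : ℝ, 0 < t ∧ t ≤ 1 / (i + 1 : ℝ) ∧
      pair (y (i + N)) (g (y (i + N))) ∈
        proj (pair (y (i + N) + t • s (i + N)) (g (y (i + N)) - t)) (epi φ) := by
    intro i
    obtain ⟨c, hc⟩ := h (i + N)
    have hUi := hN (i + N) (Nat.le_add_left N i)
    obtain ⟨ρ, hρ, hball⟩ := Metric.eventually_nhds_iff.1 (hc.and hUi)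
    have := exists_mem_proj_epi (v := s (i + N)) (c := c) (hφ _ (mem_of_mem_nhds hUi)) hρ
      (fun y' hy' => by
        have := hball (y := y') (by rwa [dist_eq_norm])
        rw [hφ _ this.2]
        exact_mod_cast this.1)
    have h1 : ∀ᶠ t in 𝓝[>] (0 : ℝ), t ≤ 1 / (i + 1 : ℝ) :=
      nhdsWithin_le_nhds (eventually_le_nhds (by positivity))
    obtain ⟨t, ht⟩ := (this.and (h1.and self_mem_nhdsWithin)).exists
    exact ⟨t, ht.2.2, ht.2.1, ht.1⟩
  choose t ht0 ht1 ht using hstep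
  have htl : Tendsto t atTop (𝓝 0) :=
    squeeze_zero (fun i => (ht0 i).le) ht1 tendsto_one_div_add_atTop_nhds_zero_nat
  have hyN : Tendsto (fun i => y (i + N)) atTop (𝓝 x) := (tendsto_add_atTop_iff_nat N).2 hy
  have hsN : Tendsto (fun i => s (i + N)) atTop (𝓝 v) := (tendsto_add_atTop_iff_nat N).2 hs
  have hgx : Tendsto (fun i => g (y (i + N))) atTop (𝓝 (g x)) :=
    ((hg.continuousAt hU).tendsto).comp hyN
  have hpair : Continuous fun q : E × ℝ => pair q.1 q.2 := WithLp.prod_continuous_toLp 2 E ℝ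
  refine ⟨g x, hφ x (mem_of_mem_nhds hU), ?_,
    fun i => pair (y (i + N) + t i • s (i + N)) (g (y (i + N)) - t i),
    fun i => pair (s (i + N)) (-1), ?_, ?_, fun i => ⟨(t i)⁻¹, (inv_pos.2 (ht0 i)).le, _, ht i, ?_⟩⟩
  · simp [epi, pair, hφ x (mem_of_mem_nhds hU)]
  · have h1 : Tendsto (fun i => (y (i + N) + t i • s (i + N), g (y (i + N)) - t i)) atTop
        (𝓝 (x + (0 : ℝ) • v, g x - 0)) :=
      (hyN.add (htl.smul hsN)).prodMk_nhds (hgx.sub htl)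
    simpa [Function.comp_def] using (hpair.tendsto _).comp h1
  · exact (hpair.tendsto (v, -1)).comp (hsN.prodMk_nhds tendsto_const_nhds)
  · have := (ht0 i).ne'
    apply (WithLp.equiv 2 _).injective
    apply Prod.ext
    · simp [pair, this]
    · simp [pair, this]

/-- Limiting normals to convex sets are normals in the sense of convex analysis. -/
theorem inner_le_zero_of_mem_limitingNormalCone {Ω : Set E} (hΩ : Convex ℝ Ω) {x v : E}
    (hv : v ∈ limitingNormalCone x Ω) {y : E} (hy : y ∈ Ω) : ⟪v, y - x⟫ ≤ 0 := by
  obtain ⟨hx, a, b, ha, hb, h⟩ := hv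
  choose c hc w hw hbw using h
  -- The projections also tend to `x`, because `x` itself competes in `Ω`; the variational
  -- inequality of the projection then passes to the limit.
  have hwx : Tendsto w atTop (𝓝 x) := by
    rw [tendsto_iff_norm_sub_tendsto_zero] at ha ⊢
    refine squeeze_zero (fun _ => norm_nonneg _) (g := fun i => 2 * ‖a i - x‖) (fun i => ?_)
      (by simpa using ha.const_mul 2)
    calc ‖w i - x‖ ≤ ‖w i - a i‖ + ‖a i - x‖ := norm_sub_le_norm_sub_add_norm_sub _ _ _
      _ ≤ ‖a i - x‖ + ‖a i - x‖ := by
        rw [norm_sub_rev (w i)]; gcongr; exact (hw i).2 x hx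
      _ = 2 * ‖a i - x‖ := by ring
  refine le_of_tendsto (hb.inner (hwx.const_sub y)) (Eventually.of_forall fun i => ?_)
  have hinf : ‖a i - w i‖ = ⨅ z : Ω, ‖a i - z‖ := by
    have : Nonempty Ω := ⟨⟨x, hx⟩⟩
    exact le_antisymm (le_ciInf fun z => (hw i).2 z z.2)
      (ciInf_le ⟨0, by rintro _ ⟨z, rfl⟩; exact norm_nonneg _⟩ (⟨w i, (hw i).1⟩ : Ω))
  have := (norm_eq_iInf_iff_real_inner_le_zero hΩ (hw i).1).1 hinf y hy
  rw [hbw i, real_inner_smul_left]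
  exact mul_nonpos_of_nonneg_of_nonpos (hc i) this

theorem smul_mem_limitingNormalCone {Ω : Set E} {x v : E} (hv : v ∈ limitingNormalCone x Ω)
    {a : ℝ} (ha : 0 ≤ a) : a • v ∈ limitingNormalCone x Ω := by
  obtain ⟨hx, p, q, hp, hq, h⟩ := hv
  refine ⟨hx, p, fun i => a • q i, hp, hq.const_smul a, fun i => ?_⟩
  obtain ⟨c, hc, w, hw, hqw⟩ := h i
  exact ⟨a * c, mul_nonneg ha hc, w, hw, by simp only [hqw, smul_smul]⟩

end Normals

/-! ### Stationary points of the penalized problems -/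

section Multipliers

/-- Allows joint minimality over all copies to be tested in a single copy. -/
theorem sum_update_sub_sum {ι : Type*} [Fintype ι] [DecidableEq ι] {X : ι → Type*}
    (F : ∀ i, X i → ℝ) (y : ∀ i, X i) (i₀ : ι) (a : X i₀) :
    ∑ i, F i (Function.update y i₀ a i) - ∑ i, F i (y i) = F i₀ a - F i₀ (y i₀) := by
  rw [← Finset.sum_sub_distrib, Finset.sum_eq_single i₀]
  · simp
  · intro i _ hi
    simp [Function.update_of_ne hi]
  · simp

theorem norm_sub_sq_sub_norm_sub_sq {Y : Type*} [NormedAddCommGroup Y] [InnerProductSpace ℝ Y]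
    (a y y' : Y) : ‖a - y'‖ ^ 2 - ‖a - y‖ ^ 2 = ‖y' - y‖ ^ 2 - 2 * ⟪a - y, y' - y⟫ := by
  have : a - y' = (a - y) - (y' - y) := by abel
  rw [this, norm_sub_sq_real]
  ring

variable {E : Type} [NormedAddCommGroup E] [NormedSpace ℝ E] [FiniteDimensional ℝ E]

/-- Stationary points of quadratic penalizations that approximate a strict local minimizer of
`∑ i, g i (A i z) + S z` subject to `B j z ∈ Ω j`. -/
theorem exists_penalized_stationary_points {ι κ : Type} [Fintype ι] [Fintype κ]
    {Y : ι → Type} {V : κ → Type}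
    [∀ i, NormedAddCommGroup (Y i)] [∀ i, InnerProductSpace ℝ (Y i)]
    [∀ i, FiniteDimensional ℝ (Y i)]
    [∀ j, NormedAddCommGroup (V j)] [∀ j, InnerProductSpace ℝ (V j)]
    [∀ j, FiniteDimensional ℝ (V j)]
    {g : ∀ i, Y i → ℝ} {A : ∀ i, E → Y i} {A' : ∀ i, E → E →L[ℝ] Y i}
    {B : ∀ j, E → V j} {B' : ∀ j, E → E →L[ℝ] V j} {S : E → ℝ} {S' : E → E →L[ℝ] ℝ}
    {Ω : ∀ j, Set (V j)} {z₀ : E}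
    (hA : ∀ i z, HasFDerivAt (A i) (A' i z) z) (hB : ∀ j z, HasFDerivAt (B j) (B' j z) z)
    (hS : ∀ z, HasFDerivAt S (S' z) z)
    (hΩ : ∀ j, IsClosed (Ω j)) (hz₀ : ∀ j, B j z₀ ∈ Ω j)
    (hg : ∀ i, ∃ K : NNReal, ∃ U ∈ 𝓝 (A i z₀), LipschitzOnWith K (g i) U)
    (hmin : ∀ᶠ z in 𝓝 z₀, (∀ j, B j z ∈ Ω j) → z ≠ z₀ →
      ∑ i, g i (A i z₀) + S z₀ < ∑ i, g i (A i z) + S z) :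
    ∃ (z : ℕ → E) (y : ℕ → ∀ i, Y i) (q : ℕ → ∀ j, V j) (c : ℕ → ℝ) (L : ι → ℝ),
      Tendsto z atTop (𝓝 z₀) ∧ (∀ i, Tendsto (fun N => y N i) atTop (𝓝 (A i z₀))) ∧
      ∀ N, 0 ≤ c N ∧
        (∀ i, ∃ b : ℝ, ∀ᶠ y' in 𝓝 (y N i),
          g i (y N i) + ⟪c N • (A i (z N) - y N i), y' - y N i⟫ - b * ‖y' - y N i‖ ^ 2
            ≤ g i y') ∧
        (∀ i, ‖c N • (A i (z N) - y N i)‖ ≤ L i) ∧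
        (∀ j, q N j ∈ proj (B j (z N)) (Ω j)) ∧
        ∀ δ, ∑ i, ⟪c N • (A i (z N) - y N i), A' i (z N) δ⟫ + S' (z N) δ
          + ∑ j, ⟪c N • (B j (z N) - q N j), B' j (z N) δ⟫ = 0 := by
  classical
  have hAc : ∀ i, Continuous (A i) := fun i =>
    continuous_iff_continuousAt.2 fun z => (hA i z).continuousAt
  have hBc : ∀ j, Continuous (B j) := fun j =>
    continuous_iff_continuousAt.2 fun z => (hB j z).continuousAt
  have hSc : Continuous S := continuous_iff_continuousAt.2 fun z => (hS z).continuousAt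
  choose L U hU hL using hg
  have hr : ∀ i, ∃ r > 0, Metric.closedBall (A i z₀) r ⊆ U i := fun i =>
    Metric.nhds_basis_closedBall.mem_iff.1 (hU i)
  choose r hr0 hrU using hr
  have hAr : ∀ᶠ z in 𝓝 z₀, ∀ i, A i z ∈ Metric.closedBall (A i z₀) (r i) :=
    eventually_all.2 fun i => (hAc i).continuousAt.eventually
      (Metric.closedBall_mem_nhds _ (hr0 i))
  obtain ⟨δ, hδ, hball⟩ := Metric.nhds_basis_closedBall.mem_iff.1 (hmin.and hAr)
  -- The balls around `A i z₀` lie where `g i` is Lipschitz; the unit balls only serve to make the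
  -- problem compact.
  let K : Set (E × (∀ i, Y i) × (∀ j, V j)) := Metric.closedBall z₀ δ ×ˢ
    (Set.univ.pi fun i => Metric.closedBall (A i z₀) (r i)) ×ˢ
    (Set.univ.pi fun j => Ω j ∩ Metric.closedBall (B j z₀) 1)
  have hK : IsCompact K := by
    have := FiniteDimensional.proper ℝ E
    have := fun i => FiniteDimensional.proper ℝ (Y i)
    have := fun j => FiniteDimensional.proper ℝ (V j)
    exact (isCompact_closedBall _ _).prod ((isCompact_univ_pi fun i => isCompact_closedBall _ _).prod
      (isCompact_univ_pi fun j => (isCompact_closedBall _ _).inter_left (hΩ j)))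
  let Φ : E × (∀ i, Y i) × (∀ j, V j) → ℝ := fun w => ∑ i, g i (w.2.1 i) + S w.1
  let ρ : E × (∀ i, Y i) × (∀ j, V j) → ℝ := fun w =>
    ∑ i, ‖A i w.1 - w.2.1 i‖ ^ 2 + ∑ j, ‖B j w.1 - w.2.2 j‖ ^ 2
  have hρ : Continuous ρ := by
    refine (continuous_finsetSum _ fun i _ => ?_).add (continuous_finsetSum _ fun j _ => ?_)
    · exact (((hAc i).comp continuous_fst).sub (by fun_prop)).norm.pow 2
    · exact (((hBc j).comp continuous_fst).sub (by fun_prop)).norm.pow 2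
  have hΦ : ContinuousOn Φ K := by
    refine (continuousOn_finsetSum _ fun i _ => ?_).add (hSc.comp continuous_fst).continuousOn
    have : ContinuousOn (g i) (Metric.closedBall (A i z₀) (r i)) :=
      (hL i).continuousOn.mono (hrU i)
    refine this.comp (f := fun w : E × (∀ i, Y i) × (∀ j, V j) => w.2.1 i)
      (Continuous.continuousOn (by fun_prop)) ?_
    exact fun w hw => hw.2.1 i (Set.mem_univ i)
  obtain ⟨w, hw, hwmin⟩ := exists_tendsto_penalized_minimizers hK hΦ hρ.continuousOn
    (fun w _ => by positivity) (w₀ := (z₀, (fun i => A i z₀), fun j => B j z₀))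
    ⟨Metric.mem_closedBall_self hδ.le, fun i _ => Metric.mem_closedBall_self (hr0 i).le,
      fun j _ => ⟨hz₀ j, Metric.mem_closedBall_self zero_le_one⟩⟩ (by simp [ρ]) (by
      rintro ⟨z, y, q⟩ ⟨hz, hy, hq⟩ h0 hne
      have h1 : ∑ i, ‖A i z - y i‖ ^ 2 = 0 ∧ ∑ j, ‖B j z - q j‖ ^ 2 = 0 :=
        (add_eq_zero_iff_of_nonneg (by positivity) (by positivity)).1 h0
      have hy' : y = fun i => A i z := by
        funext i
        have := (Finset.sum_eq_zero_iff_of_nonneg (fun i _ => by positivity)).1 h1.1 i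
          (Finset.mem_univ i)
        exact (sub_eq_zero.1 (by simpa using this)).symm
      have hq' : q = fun j => B j z := by
        funext j
        have := (Finset.sum_eq_zero_iff_of_nonneg (fun i _ => by positivity)).1 h1.2 j
          (Finset.mem_univ j)
        exact (sub_eq_zero.1 (by simpa using this)).symm
      subst hy' hq'
      refine (hball hz).1 (fun j => (hq j (Set.mem_univ j)).1) ?_
      rintro rfl
      exact hne rfl)
  have hz : Tendsto (fun N => (w N).1) atTop (𝓝 z₀) := (continuous_fst.tendsto _).comp hw
  have hy : ∀ i, Tendsto (fun N => (w N).2.1 i) atTop (𝓝 (A i z₀)) := fun i =>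
    (Continuous.tendsto (f := fun w : E × (∀ i, Y i) × (∀ j, V j) => w.2.1 i)
      (by fun_prop) _).comp hw
  have hq : ∀ j, Tendsto (fun N => (w N).2.2 j) atTop (𝓝 (B j z₀)) := fun j =>
    (Continuous.tendsto (f := fun w : E × (∀ i, Y i) × (∀ j, V j) => w.2.2 j)
      (by fun_prop) _).comp hw
  -- Eventually the minimizers are interior to the artificial balls. The last condition ensures that
  -- any point closer to `B j z` than the copy `q j` still lies in the unit ball around `B j z₀`.
  have hev : ∀ᶠ N in atTop, (w N).1 ∈ Metric.ball z₀ δ ∧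
      (∀ i, (w N).2.1 i ∈ Metric.ball (A i z₀) (r i)) ∧
      ∀ j, ‖B j (w N).1 - (w N).2.2 j‖ + ‖B j (w N).1 - B j z₀‖ < 1 := by
    refine (hz.eventually (Metric.ball_mem_nhds _ hδ)).and ((eventually_all.2 fun i =>
      (hy i).eventually (Metric.ball_mem_nhds _ (hr0 i))).and (eventually_all.2 fun j => ?_))
    have hBz := ((hBc j).tendsto z₀).comp hz
    have := ((hBz.sub (hq j)).norm).add ((hBz.sub_const (B j z₀)).norm)
    exact this.eventually_lt_const (by simp)
  obtain ⟨N₀, hN₀⟩ := eventually_atTop.1 hev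
  -- The factor `2 * M` comes from differentiating `M * ‖·‖ ^ 2`. Starting after `N₀` gives `M > 0`
  -- as well as interiority.
  suffices key : ∀ M : ℕ, N₀ < M → ∀ z y q, w M = (z, y, q) → 0 ≤ 2 * (M : ℝ) ∧
      (∀ i, ∃ b : ℝ, ∀ᶠ y' in 𝓝 (y i),
        g i (y i) + ⟪(2 * (M : ℝ)) • (A i z - y i), y' - y i⟫ - b * ‖y' - y i‖ ^ 2 ≤ g i y') ∧
      (∀ i, ‖(2 * (M : ℝ)) • (A i z - y i)‖ ≤ 2 * L i) ∧
      (∀ j, q j ∈ proj (B j z) (Ω j)) ∧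
      ∀ δ, ∑ i, ⟪(2 * (M : ℝ)) • (A i z - y i), A' i z δ⟫ + S' z δ
        + ∑ j, ⟪(2 * (M : ℝ)) • (B j z - q j), B' j z δ⟫ = 0 from
    ⟨fun N => (w (N + (N₀ + 1))).1, fun N => (w (N + (N₀ + 1))).2.1,
      fun N => (w (N + (N₀ + 1))).2.2, fun N => 2 * ((N + (N₀ + 1) : ℕ) : ℝ), fun i => 2 * L i,
      (tendsto_add_atTop_iff_nat (N₀ + 1)).2 hz,
      fun i => (tendsto_add_atTop_iff_nat (f := fun N => (w N).2.1 i) (N₀ + 1)).2 (hy i),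
      fun N => key _ (by omega) _ _ _ rfl⟩
  intro M hM z y q hwM
  obtain ⟨hzb, hyb, hqb⟩ := hN₀ M hM.le
  obtain ⟨hwK, hwm⟩ := hwmin M
  rw [hwM] at hzb hyb hqb hwK hwm
  simp only [] at hzb hyb hqb
  have hM0 : 0 < (M : ℝ) := by exact_mod_cast (Nat.zero_le _).trans_lt hM
  have hupd : ∀ i, ∀ y' ∈ Metric.closedBall (A i z₀) (r i),
      g i (y i) + M * ‖A i z - y i‖ ^ 2 ≤ g i y' + M * ‖A i z - y'‖ ^ 2 := by
    intro i y' hy'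
    have h1 := hwm (z, Function.update y i y', q) ⟨hwK.1, fun i' _ => by
      by_cases h : i' = i
      · subst h; simpa using hy'
      · simpa [Function.update_of_ne h] using hwK.2.1 i' (Set.mem_univ i'), hwK.2.2⟩
    have h2 := sum_update_sub_sum g y i y'
    have h3 := sum_update_sub_sum (fun i y => ‖A i z - y‖ ^ 2) y i y'
    simp only [Φ, ρ] at h1 h2 h3
    rw [sub_eq_iff_eq_add] at h2 h3
    rw [h2, h3] at h1
    nlinarith
  refine ⟨by positivity, fun i => ⟨M, ?_⟩, fun i => ?_, fun j => ?_, ?_⟩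
  · filter_upwards [Metric.isOpen_ball.mem_nhds (hyb i)] with y' hy'
    have h1 := hupd i y' (Metric.ball_subset_closedBall hy')
    have h2 := norm_sub_sq_sub_norm_sub_sq (A i z) (y i) y'
    rw [sub_eq_iff_eq_add] at h2
    rw [h2] at h1
    rw [real_inner_smul_left]
    linarith
  -- Comparing the copy `y i` with `A i z` itself gives `M * ‖A i z - y i‖ ^ 2 ≤ L i * ‖A i z - y
  -- i‖`, a bound independent of `M`.
  · have hAz := (hball (Metric.ball_subset_closedBall hzb)).2 i
    have h1 := hupd i _ hAz
    have h2 := (hL i).dist_le_mul _ (hrU i hAz) _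
      (hrU i (Metric.ball_subset_closedBall (hyb i)))
    rw [Real.dist_eq, dist_eq_norm] at h2
    have h3 := le_abs_self (g i (A i z) - g i (y i))
    rw [sub_self, norm_zero] at h1
    rw [norm_smul, Real.norm_of_nonneg (by positivity), mul_assoc]
    rcases (norm_nonneg (A i z - y i)).eq_or_lt with h0 | h0
    · rw [← h0]; simp
    · have : (M * ‖A i z - y i‖) * ‖A i z - y i‖ ≤ L i * ‖A i z - y i‖ := by nlinarith
      linarith [le_of_mul_le_mul_right this h0]
  · refine ⟨(hwK.2.2 j (Set.mem_univ j)).1, fun q' hq' => ?_⟩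
    by_contra! hlt
    have hq'b : q' ∈ Metric.closedBall (B j z₀) 1 := by
      rw [mem_closedBall_iff_norm]
      calc ‖q' - B j z₀‖ ≤ ‖q' - B j z‖ + ‖B j z - B j z₀‖ :=
            norm_sub_le_norm_sub_add_norm_sub _ _ _
        _ ≤ 1 := by rw [norm_sub_rev q']; linarith [hqb j]
    have h5 := hwm (z, y, Function.update q j q') ⟨hwK.1, hwK.2.1, fun j' _ => by
      by_cases h : j' = j
      · subst h; simpa using ⟨hq', hq'b⟩
      · simpa [Function.update_of_ne h] using hwK.2.2 j' (Set.mem_univ j')⟩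
    have h3 := sum_update_sub_sum (fun j q => ‖B j z - q‖ ^ 2) q j q'
    simp only [Φ, ρ] at h5 h3
    rw [sub_eq_iff_eq_add] at h3
    rw [h3] at h5
    have h6 : ‖B j z - q'‖ ^ 2 < ‖B j z - q j‖ ^ 2 := pow_lt_pow_left₀ hlt (norm_nonneg _) two_ne_zero
    have h7 := mul_lt_mul_of_pos_left h6 hM0
    linarith
  -- With the copies frozen, the objective is smooth in `z`, so Fermat's rule applies.
  · have hloc : IsLocalMin (fun z' => S z' + M * (∑ i, ‖A i z' - y i‖ ^ 2
        + ∑ j, ‖B j z' - q j‖ ^ 2)) z := by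
      filter_upwards [Metric.isOpen_ball.mem_nhds hzb] with z' hz'
      have h1 := hwm (z', y, q) ⟨Metric.ball_subset_closedBall hz', hwK.2⟩
      simp only [Φ, ρ] at h1
      linarith
    have hd := (hS z).add (((HasFDerivAt.fun_sum fun i (_ : i ∈ Finset.univ) =>
      ((hA i z).sub_const (y i)).norm_sq).add (HasFDerivAt.fun_sum fun j (_ : j ∈ Finset.univ) =>
      ((hB j z).sub_const (q j)).norm_sq)).const_mul (M : ℝ))
    intro δ
    have h0 := congrArg (fun T : E →L[ℝ] ℝ => T δ) (hloc.hasFDerivAt_eq_zero hd)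
    simp only [add_apply, smul_apply, sum_apply,
      ContinuousLinearMap.comp_apply, innerSL_apply_apply, smul_eq_mul, zero_apply] at h0
    simp only [real_inner_smul_left]
    rw [← h0, ← Finset.mul_sum, ← Finset.mul_sum]
    simp only [nsmul_eq_mul, Nat.cast_ofNat, ← Finset.mul_sum]
    ring

end Multipliers

/-! ### The limiting multiplier rule -/

section Multipliers

variable {E : Type} [NormedAddCommGroup E] [NormedSpace ℝ E] [FiniteDimensional ℝ E]

/-- Lagrange multiplier rule in limiting form for a strict local minimizer of
`∑ i, g i (A i z) + S z` subject to `B j z ∈ Ω j`. -/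
theorem exists_limiting_multipliers {ι κ : Type} [Fintype ι] [Fintype κ]
    {Y : ι → Type} {V : κ → Type}
    [∀ i, NormedAddCommGroup (Y i)] [∀ i, InnerProductSpace ℝ (Y i)]
    [∀ i, FiniteDimensional ℝ (Y i)]
    [∀ j, NormedAddCommGroup (V j)] [∀ j, InnerProductSpace ℝ (V j)]
    [∀ j, FiniteDimensional ℝ (V j)]
    {g : ∀ i, Y i → ℝ} {A : ∀ i, E → Y i} {A' : ∀ i, E → E →L[ℝ] Y i}
    {B : ∀ j, E → V j} {B' : ∀ j, E → E →L[ℝ] V j} {S : E → ℝ} {S' : E → E →L[ℝ] ℝ}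
    {Ω : ∀ j, Set (V j)} {z₀ : E}
    (hA : ∀ i z, HasFDerivAt (A i) (A' i z) z) (hB : ∀ j z, HasFDerivAt (B j) (B' j z) z)
    (hS : ∀ z, HasFDerivAt S (S' z) z)
    (hA' : ∀ i, Continuous (A' i)) (hB' : ∀ j, Continuous (B' j)) (hS' : Continuous S')
    (hΩ : ∀ j, IsClosed (Ω j)) (hz₀ : ∀ j, B j z₀ ∈ Ω j)
    (hg : ∀ i, ∃ K : NNReal, ∃ U ∈ 𝓝 (A i z₀), LipschitzOnWith K (g i) U)
    (hmin : ∀ᶠ z in 𝓝 z₀, (∀ j, B j z ∈ Ω j) → z ≠ z₀ →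
      ∑ i, g i (A i z₀) + S z₀ < ∑ i, g i (A i z) + S z) :
    ∃ (lam : ℝ) (v : ∀ i, Y i) (η : ∀ j, V j), 0 ≤ lam ∧ lam + ∑ j, ‖η j‖ = 1 ∧
      (∀ i, IsLimitProximalSubgradient (g i) (A i z₀) (v i)) ∧
      (∀ j, η j ∈ limitingNormalCone (B j z₀) (Ω j)) ∧
      ∀ δ, lam * (∑ i, ⟪v i, A' i z₀ δ⟫ + S' z₀ δ) + ∑ j, ⟪η j, B' j z₀ δ⟫ = 0 := by
  obtain ⟨z, y, q, c, L, hz, hy, h⟩ :=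
    exists_penalized_stationary_points hA hB hS hΩ hz₀ hg hmin
  choose hc hprox hL hproj hstat using h
  set s : ℕ → ∀ i, Y i := fun N i => c N • (A i (z N) - y N i) with hs
  set e : ℕ → ∀ j, V j := fun N j => c N • (B j (z N) - q N j) with he
  -- Only the constraint multipliers can be unbounded: the subgradients obey the Lipschitz bounds.
  -- Hence the normalization involves `e` alone, and `lam` is the limit of `(Λ N)⁻¹`.
  set Λ : ℕ → ℝ := fun N => 1 + ∑ j, ‖e N j‖ with hΛ
  have hΛ1 : ∀ N, 1 ≤ Λ N := fun N => by
    have : 0 ≤ ∑ j, ‖e N j‖ := by positivity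
    linarith
  have hΛ0 : ∀ N, 0 < Λ N := fun N => zero_lt_one.trans_le (hΛ1 N)
  let K : Set (ℝ × (∀ i, Y i) × (∀ j, V j)) := Set.Icc 0 1 ×ˢ
    (Set.univ.pi fun i => Metric.closedBall 0 (L i)) ×ˢ
    (Set.univ.pi fun j => Metric.closedBall 0 1)
  have hK : IsCompact K := by
    have := fun i => FiniteDimensional.proper ℝ (Y i)
    have := fun j => FiniteDimensional.proper ℝ (V j)
    exact isCompact_Icc.prod ((isCompact_univ_pi fun i => isCompact_closedBall _ _).prod
      (isCompact_univ_pi fun j => isCompact_closedBall _ _))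
  obtain ⟨⟨lam, v, η⟩, hmem, σ, hσ, hlim⟩ := hK.tendsto_subseq
    (x := fun N => ((Λ N)⁻¹, s N, fun j => (Λ N)⁻¹ • e N j)) (fun N => by
      refine ⟨⟨(inv_pos.2 (hΛ0 N)).le, inv_le_one_of_one_le₀ (hΛ1 N)⟩, fun i _ => ?_,
        fun j _ => ?_⟩
      · simpa using hL N i
      · rw [mem_closedBall_zero_iff, norm_smul, Real.norm_of_nonneg (inv_pos.2 (hΛ0 N)).le,
          inv_mul_le_one₀ (hΛ0 N)]
        have := Finset.single_le_sum (f := fun j => ‖e N j‖) (fun j _ => norm_nonneg _)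
          (Finset.mem_univ j)
        simp only [hΛ]
        linarith)
  have hlam : Tendsto (fun N => (Λ (σ N))⁻¹) atTop (𝓝 lam) :=
    (continuous_fst.tendsto _).comp hlim
  have hv : ∀ i, Tendsto (fun N => s (σ N) i) atTop (𝓝 (v i)) := fun i =>
    (Continuous.tendsto (f := fun w : ℝ × (∀ i, Y i) × (∀ j, V j) => w.2.1 i)
      (by fun_prop) _).comp hlim
  have hη : ∀ j, Tendsto (fun N => (Λ (σ N))⁻¹ • e (σ N) j) atTop (𝓝 (η j)) := fun j =>
    (Continuous.tendsto (f := fun w : ℝ × (∀ i, Y i) × (∀ j, V j) => w.2.2 j)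
      (by fun_prop) _).comp hlim
  have hzσ : Tendsto (fun N => z (σ N)) atTop (𝓝 z₀) := hz.comp hσ.tendsto_atTop
  refine ⟨lam, v, η, hmem.1.1, ?_, fun i => ?_, fun j => ?_, fun δ => ?_⟩
  · have h1 : Tendsto (fun N => (Λ (σ N))⁻¹ + ∑ j, ‖(Λ (σ N))⁻¹ • e (σ N) j‖) atTop
        (𝓝 (lam + ∑ j, ‖η j‖)) := hlam.add (tendsto_finsetSum _ fun j _ => (hη j).norm)
    refine tendsto_nhds_unique h1 (tendsto_const_nhds.congr fun N => ?_)
    have := (hΛ0 (σ N)).ne'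
    simp only [norm_smul, norm_inv, Real.norm_of_nonneg (hΛ0 (σ N)).le, ← Finset.mul_sum]
    have h2 : (Λ (σ N))⁻¹ * Λ (σ N) = 1 := inv_mul_cancel₀ this
    simp only [hΛ] at h2 ⊢
    linarith
  · exact ⟨fun N => y (σ N) i, fun N => s (σ N) i,
      (hy i).comp hσ.tendsto_atTop, hv i, fun N => hprox (σ N) i⟩
  · refine ⟨hz₀ j, fun N => B j (z (σ N)), fun N => (Λ (σ N))⁻¹ • e (σ N) j,
      (hB j z₀).continuousAt.tendsto.comp hzσ, hη j, fun N => ⟨(Λ (σ N))⁻¹ * c (σ N),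
        mul_nonneg (inv_pos.2 (hΛ0 _)).le (hc _), q (σ N) j, hproj _ j, ?_⟩⟩
    simp only [he, smul_smul]
  · have hA'δ : ∀ i, Tendsto (fun N => A' i (z (σ N)) δ) atTop (𝓝 (A' i z₀ δ)) := fun i =>
      (((hA' i).clm_apply continuous_const).tendsto z₀).comp hzσ
    have hB'δ : ∀ j, Tendsto (fun N => B' j (z (σ N)) δ) atTop (𝓝 (B' j z₀ δ)) := fun j =>
      (((hB' j).clm_apply continuous_const).tendsto z₀).comp hzσ
    have hS'δ : Tendsto (fun N => S' (z (σ N)) δ) atTop (𝓝 (S' z₀ δ)) :=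
      ((hS'.clm_apply continuous_const).tendsto z₀).comp hzσ
    have h1 := (hlam.mul ((tendsto_finsetSum Finset.univ fun i _ =>
      (hv i).inner (𝕜 := ℝ) (hA'δ i)).add hS'δ)).add (tendsto_finsetSum Finset.univ fun j _ =>
        (hη j).inner (𝕜 := ℝ) (hB'δ j))
    refine tendsto_nhds_unique h1 (tendsto_const_nhds.congr fun N => ?_)
    have := hstat (σ N) δ
    simp only [real_inner_smul_left, ← Finset.mul_sum, hs, he] at this ⊢
    rw [← mul_add, this, mul_zero]

/-- Multiplier rule with two families of costs and two families of constraints. -/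
theorem exists_limiting_multipliers_sum {ι₁ ι₂ κ₁ κ₂ : Type}
    [Fintype ι₁] [Fintype ι₂] [Fintype κ₁] [Fintype κ₂] {Y₁ Y₂ V₁ V₂ : Type}
    [NormedAddCommGroup Y₁] [InnerProductSpace ℝ Y₁] [FiniteDimensional ℝ Y₁]
    [NormedAddCommGroup Y₂] [InnerProductSpace ℝ Y₂] [FiniteDimensional ℝ Y₂]
    [NormedAddCommGroup V₁] [InnerProductSpace ℝ V₁] [FiniteDimensional ℝ V₁]
    [NormedAddCommGroup V₂] [InnerProductSpace ℝ V₂] [FiniteDimensional ℝ V₂]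
    {g₁ : ι₁ → Y₁ → ℝ} {A₁ : ι₁ → E → Y₁} {A₁' : ι₁ → E → E →L[ℝ] Y₁}
    {g₂ : ι₂ → Y₂ → ℝ} {A₂ : ι₂ → E → Y₂} {A₂' : ι₂ → E → E →L[ℝ] Y₂}
    {B₁ : κ₁ → E → V₁} {B₁' : κ₁ → E → E →L[ℝ] V₁} {Ω₁ : κ₁ → Set V₁}
    {B₂ : κ₂ → E → V₂} {B₂' : κ₂ → E → E →L[ℝ] V₂} {Ω₂ : κ₂ → Set V₂}
    {S : E → ℝ} {S' : E → E →L[ℝ] ℝ} {z₀ : E}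
    (hA₁ : ∀ i z, HasFDerivAt (A₁ i) (A₁' i z) z) (hA₂ : ∀ i z, HasFDerivAt (A₂ i) (A₂' i z) z)
    (hB₁ : ∀ j z, HasFDerivAt (B₁ j) (B₁' j z) z) (hB₂ : ∀ j z, HasFDerivAt (B₂ j) (B₂' j z) z)
    (hS : ∀ z, HasFDerivAt S (S' z) z)
    (hA₁' : ∀ i, Continuous (A₁' i)) (hA₂' : ∀ i, Continuous (A₂' i))
    (hB₁' : ∀ j, Continuous (B₁' j)) (hB₂' : ∀ j, Continuous (B₂' j)) (hS' : Continuous S')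
    (hΩ₁ : ∀ j, IsClosed (Ω₁ j)) (hΩ₂ : ∀ j, IsClosed (Ω₂ j))
    (hz₁ : ∀ j, B₁ j z₀ ∈ Ω₁ j) (hz₂ : ∀ j, B₂ j z₀ ∈ Ω₂ j)
    (hg₁ : ∀ i, ∃ K : NNReal, ∃ U ∈ 𝓝 (A₁ i z₀), LipschitzOnWith K (g₁ i) U)
    (hg₂ : ∀ i, ∃ K : NNReal, ∃ U ∈ 𝓝 (A₂ i z₀), LipschitzOnWith K (g₂ i) U)
    (hmin : ∀ᶠ z in 𝓝 z₀, (∀ j, B₁ j z ∈ Ω₁ j) → (∀ j, B₂ j z ∈ Ω₂ j) → z ≠ z₀ →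
      ∑ i, g₁ i (A₁ i z₀) + ∑ i, g₂ i (A₂ i z₀) + S z₀
        < ∑ i, g₁ i (A₁ i z) + ∑ i, g₂ i (A₂ i z) + S z) :
    ∃ (lam : ℝ) (v₁ : ι₁ → Y₁) (v₂ : ι₂ → Y₂) (η₁ : κ₁ → V₁) (η₂ : κ₂ → V₂), 0 ≤ lam ∧
      lam + (∑ j, ‖η₁ j‖ + ∑ j, ‖η₂ j‖) = 1 ∧
      (∀ i, IsLimitProximalSubgradient (g₁ i) (A₁ i z₀) (v₁ i)) ∧
      (∀ i, IsLimitProximalSubgradient (g₂ i) (A₂ i z₀) (v₂ i)) ∧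
      (∀ j, η₁ j ∈ limitingNormalCone (B₁ j z₀) (Ω₁ j)) ∧
      (∀ j, η₂ j ∈ limitingNormalCone (B₂ j z₀) (Ω₂ j)) ∧
      ∀ δ, lam * (∑ i, ⟪v₁ i, A₁' i z₀ δ⟫ + ∑ i, ⟪v₂ i, A₂' i z₀ δ⟫ + S' z₀ δ)
        + (∑ j, ⟪η₁ j, B₁' j z₀ δ⟫ + ∑ j, ⟪η₂ j, B₂' j z₀ δ⟫) = 0 := by
  -- Built by cases on the sum type, the spaces and instances reduce definitionally to the given
  -- ones on each summand.
  let Y : ι₁ ⊕ ι₂ → Type := Sum.elim (fun _ => Y₁) fun _ => Y₂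
  let V : κ₁ ⊕ κ₂ → Type := Sum.elim (fun _ => V₁) fun _ => V₂
  let iY : ∀ i, NormedAddCommGroup (Y i) := Sum.rec (fun _ => ‹NormedAddCommGroup Y₁›)
    fun _ => ‹NormedAddCommGroup Y₂›
  let : ∀ i, InnerProductSpace ℝ (Y i) := Sum.rec (fun _ => ‹InnerProductSpace ℝ Y₁›)
    fun _ => ‹InnerProductSpace ℝ Y₂›
  let : ∀ i, FiniteDimensional ℝ (Y i) := Sum.rec (fun _ => ‹FiniteDimensional ℝ Y₁›)
    fun _ => ‹FiniteDimensional ℝ Y₂›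
  let iV : ∀ j, NormedAddCommGroup (V j) := Sum.rec (fun _ => ‹NormedAddCommGroup V₁›)
    fun _ => ‹NormedAddCommGroup V₂›
  let : ∀ j, InnerProductSpace ℝ (V j) := Sum.rec (fun _ => ‹InnerProductSpace ℝ V₁›)
    fun _ => ‹InnerProductSpace ℝ V₂›
  let : ∀ j, FiniteDimensional ℝ (V j) := Sum.rec (fun _ => ‹FiniteDimensional ℝ V₁›)
    fun _ => ‹FiniteDimensional ℝ V₂›
  obtain ⟨lam, v, η, h0, h1, hv, hη, h⟩ := exists_limiting_multipliers (Y := Y) (V := V)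
    (g := Sum.rec g₁ g₂) (A := Sum.rec A₁ A₂) (A' := Sum.rec A₁' A₂')
    (B := Sum.rec B₁ B₂) (B' := Sum.rec B₁' B₂') (Ω := Sum.rec Ω₁ Ω₂) (z₀ := z₀)
    (Sum.rec hA₁ hA₂) (Sum.rec hB₁ hB₂) hS (Sum.rec hA₁' hA₂') (Sum.rec hB₁' hB₂') hS'
    (Sum.rec hΩ₁ hΩ₂) (Sum.rec hz₁ hz₂) (Sum.rec hg₁ hg₂) (by
      filter_upwards [hmin] with z hz hj hne
      rw [Fintype.sum_sum_type, Fintype.sum_sum_type]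
      exact hz (fun j => hj (Sum.inl j)) (fun j => hj (Sum.inr j)) hne)
  rw [Fintype.sum_sum_type] at h1
  refine ⟨lam, fun i => v (Sum.inl i), fun i => v (Sum.inr i), fun j => η (Sum.inl j),
    fun j => η (Sum.inr j), h0, h1, fun i => hv (Sum.inl i), fun i => hv (Sum.inr i),
    fun j => hη (Sum.inl j), fun j => hη (Sum.inr j), fun δ => ?_⟩
  have := h δ
  rw [Fintype.sum_sum_type, Fintype.sum_sum_type] at this
  exact this

end Multipliers

/-! ### Linear structure of the product spaces -/

variable {n m d : ℕ}

theorem inner_pair {A B : Type} [NormedAddCommGroup A] [InnerProductSpace ℝ A]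
    [NormedAddCommGroup B] [InnerProductSpace ℝ B] (a : A) (b : B) (q : EProd A B) :
    ⟪q, pair a b⟫ = ⟪q.fst, a⟫ + ⟪q.snd, b⟫ := by
  simp [pair]

theorem inner_triple (x u : Vec n) (a : Vec d) (z : State n d) :
    ⟪triple x u a, z⟫ = ⟪x, xc z⟫ + ⟪u, uc z⟫ + ⟪a, ac z⟫ := by
  simp [triple, pair, xc, uc, ac, add_assoc]

/-- The `x`-component as a continuous linear map. -/
noncomputable def xcL : State n d →L[ℝ] Vec n := WithLp.fstL 2 ℝ _ _

/-- The `u`-component as a continuous linear map. -/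
noncomputable def ucL : State n d →L[ℝ] Vec n := WithLp.fstL 2 ℝ _ _ ∘L WithLp.sndL 2 ℝ _ _

@[simp] theorem xcL_apply (z : State n d) : xcL z = xc z := rfl
@[simp] theorem ucL_apply (z : State n d) : ucL z = uc z := rfl

/-- The pairing of two continuous linear maps. -/
noncomputable def pairL {E A B : Type} [NormedAddCommGroup E] [NormedSpace ℝ E]
    [NormedAddCommGroup A] [InnerProductSpace ℝ A] [NormedAddCommGroup B] [InnerProductSpace ℝ B]
    (f : E →L[ℝ] A) (g : E →L[ℝ] B) : E →L[ℝ] EProd A B :=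
  (WithLp.prodContinuousLinearEquiv 2 ℝ A B).symm.toContinuousLinearMap ∘L (f.prod g)

@[simp] theorem pairL_apply {E A B : Type} [NormedAddCommGroup E] [NormedSpace ℝ E]
    [NormedAddCommGroup A] [InnerProductSpace ℝ A] [NormedAddCommGroup B] [InnerProductSpace ℝ B]
    (f : E →L[ℝ] A) (g : E →L[ℝ] B) (e : E) : pairL f g e = pair (f e) (g e) := rfl

theorem hasFDerivAt_pair {E A B : Type} [NormedAddCommGroup E] [NormedSpace ℝ E]
    [NormedAddCommGroup A] [InnerProductSpace ℝ A] [NormedAddCommGroup B] [InnerProductSpace ℝ B]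
    {f : E → A} {g : E → B} {f' : E →L[ℝ] A} {g' : E →L[ℝ] B} {e : E}
    (hf : HasFDerivAt f f' e) (hg : HasFDerivAt g g' e) :
    HasFDerivAt (fun e => pair (f e) (g e)) (pairL f' g') e :=
  (WithLp.prodContinuousLinearEquiv 2 ℝ A B).symm.hasFDerivAt.comp e (hf.prodMk hg)

theorem continuous_xc : Continuous (xc : State n d → Vec n) := xcL.continuous
theorem continuous_uc : Continuous (uc : State n d → Vec n) := ucL.continuous
theorem continuous_ac : Continuous (ac : State n d → Vec d) :=
  (WithLp.sndL 2 ℝ (Vec n) (Vec d) ∘L WithLp.sndL 2 ℝ _ _).continuous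

/-! ### Perturbation of the nodes and summation by parts -/

section Shift

variable {X : Type} [NormedAddCommGroup X] [InnerProductSpace ℝ X]

/-- The perturbation of the node `j` by the increments of the nodes `1, …, k`. -/
noncomputable def shift (k : ℕ) : ℕ → ((Fin k → X) →L[ℝ] X)
  | 0 => 0
  | j + 1 => if h : j < k then ContinuousLinearMap.proj ⟨j, h⟩ else 0

@[simp] theorem shift_zero (k : ℕ) : (shift k 0 : (Fin k → X) →L[ℝ] X) = 0 := rfl

theorem shift_succ_apply {k j : ℕ} (h : j < k) (e : Fin k → X) :
    shift k (j + 1) e = e ⟨j, h⟩ := by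
  simp [shift, h]

theorem shift_single {k j : ℕ} (i : Fin k) (ζ : X) :
    shift k j (Pi.single i ζ) = if j = i + 1 then ζ else 0 := by
  cases j with
  | zero => simp
  | succ j =>
    by_cases h : j < k
    · rw [shift_succ_apply h, Pi.single_apply]
      simp [Fin.ext_iff]
    · have : j ≠ i := fun h' => h (h' ▸ i.2)
      simp [shift, h, this]

/-- Summation by parts for the stationarity condition in the nodes `1, …, k`. -/
theorem node_equations_of_stationary {k : ℕ} {h : ℝ} {a b c : ℕ → X} {q : X}
    (H : ∀ δ : Fin k → X,
      ∑ j ∈ Finset.range k, (⟪a j, shift k j δ⟫ + ⟪b j, h⁻¹ • (shift k (j + 1) δ - shift k j δ)⟫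
        + ⟪c (j + 1), shift k (j + 1) δ⟫) + ⟪q, shift k k δ⟫ = 0) :
    (∀ j, j + 1 < k → h⁻¹ • b (j + 1) - h⁻¹ • b j = a (j + 1) + c (j + 1)) ∧
    (∀ j, j + 1 = k → h⁻¹ • b j + c k + q = 0) := by
  -- Moving only node `j + 1` affects two summands: index `j + 1` through `z` and the outgoing
  -- velocity, index `j` through the incoming velocity and `c`. For the last node the first of these
  -- is absent and `q` replaces it.
  have key : ∀ j (hj : j < k) ζ, ∑ i ∈ Finset.range k,
      ((if i = j + 1 then ⟪a i, ζ⟫ - h⁻¹ * ⟪b i, ζ⟫ else 0)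
        + if i = j then h⁻¹ * ⟪b i, ζ⟫ + ⟪c (i + 1), ζ⟫ else 0)
      + (if k = j + 1 then ⟪q, ζ⟫ else 0) = 0 := by
    intro j hj ζ
    refine Eq.trans ?_ (H (Pi.single ⟨j, hj⟩ ζ))
    congr 1
    · refine Finset.sum_congr rfl fun i _ => ?_
      simp only [shift_single, add_left_inj, inner_smul_right, inner_sub_right]
      split_ifs <;> simp <;> ring
    · simp only [shift_single]
      split_ifs <;> simp
  constructor
  · intro j hj
    refine ext_inner_right ℝ fun ζ => ?_
    have := key j (by omega) ζ
    rw [Finset.sum_add_distrib, Finset.sum_ite_eq', Finset.sum_ite_eq',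
      if_pos (Finset.mem_range.2 hj), if_pos (Finset.mem_range.2 (by omega)),
      if_neg (by omega)] at this
    simp only [inner_sub_left, inner_add_left, real_inner_smul_left]
    linarith
  · rintro j rfl
    refine ext_inner_right ℝ fun ζ => ?_
    have := key j (by omega) ζ
    rw [Finset.sum_add_distrib, Finset.sum_ite_eq', Finset.sum_ite_eq',
      if_neg (by simp), if_pos (Finset.mem_range.2 (by omega)), if_pos rfl] at this
    simp only [inner_add_left, real_inner_smul_left, inner_zero_left]
    linarith

end Shift

/-! ### Auxiliary estimates and closedness -/

theorem infDist_Iic_le {s μ R : ℝ} (hR : 0 ≤ R) (h : s ≤ μ + R) :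
    Metric.infDist s (Set.Iic μ) ≤ R := by
  have hmem : min s μ ∈ Set.Iic μ := Set.mem_Iic.2 (min_le_right _ _)
  refine (Metric.infDist_le_dist_of_mem hmem).trans ?_
  rw [Real.dist_eq, abs_of_nonneg (by linarith [min_le_left s μ])]
  rcases min_cases s μ with h' | h' <;> linarith [h'.1]

theorem coe_sum_ereal {ι : Type*} (s : Finset ι) (f : ι → ℝ) :
    ((∑ i ∈ s, f i : ℝ) : EReal) = ∑ i ∈ s, (f i : EReal) := by
  classical
  induction s using Finset.induction_on with
  | empty => simp
  | insert i s hi ih => rw [Finset.sum_insert hi, Finset.sum_insert hi, EReal.coe_add, ih]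

theorem isClosed_convexNormalCone_graph {E : Type} [NormedAddCommGroup E] [InnerProductSpace ℝ E]
    {C : Set E} (hC : IsClosed C) : IsClosed {q : E × E | q.2 ∈ convexNormalCone q.1 C} := by
  have : {q : E × E | q.2 ∈ convexNormalCone q.1 C}
      = {q | q.1 ∈ C} ∩ ⋂ y ∈ C, {q : E × E | ⟪q.2, y - q.1⟫ ≤ 0} := by
    ext q
    by_cases h : q.1 ∈ C <;> simp [convexNormalCone, h]
  rw [this]
  refine (hC.preimage continuous_fst).inter (isClosed_biInter fun y _ => ?_)
  exact isClosed_le (by fun_prop) continuous_const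

/-- Shows the velocity gap to be a quadratic polynomial in the discrete velocity, so no
differentiation under the integral is needed. -/
theorem exists_integral_norm_sub_sq_eq {E : Type} [NormedAddCommGroup E] [InnerProductSpace ℝ E]
    [CompleteSpace E] {f : ℝ → E} {a b : ℝ} (hf : IntervalIntegrable f volume a b)
    (hf2 : IntervalIntegrable (fun s => ‖f s‖ ^ 2) volume a b) :
    ∃ c : ℝ, ∀ V : E, ∫ s in a..b, ‖V - f s‖ ^ 2
      = (b - a) * ‖V‖ ^ 2 - 2 * ⟪V, ∫ s in a..b, f s⟫ + c := by
  refine ⟨∫ s in a..b, ‖f s‖ ^ 2, fun V => ?_⟩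
  have h1 : IntervalIntegrable (fun s => ⟪V, f s⟫) volume a b :=
    ⟨hf.1.const_inner V, hf.2.const_inner V⟩
  have h2 : ∫ s in a..b, ⟪V, f s⟫ = ⟪V, ∫ s in a..b, f s⟫ :=
    (innerSL ℝ V).intervalIntegral_comp_comm hf
  simp only [norm_sub_sq_real]
  rw [intervalIntegral.integral_add (intervalIntegrable_const.sub (h1.const_mul 2)) hf2,
    intervalIntegral.integral_sub intervalIntegrable_const (h1.const_mul 2),
    intervalIntegral.integral_const, intervalIntegral.integral_const_mul, h2, smul_eq_mul]

/-- The product carries the supremum norm, whose square is not smooth; the sum of squares is a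
smooth upper bound. -/
theorem norm_sq_le_sum_norm_sq {ι : Type*} [Fintype ι] {X : ι → Type*}
    [∀ i, SeminormedAddCommGroup (X i)] (e : ∀ i, X i) : ‖e‖ ^ 2 ≤ ∑ i, ‖e i‖ ^ 2 := by
  have h0 : 0 ≤ ∑ i, ‖e i‖ ^ 2 := by positivity
  rw [← Real.le_sqrt (norm_nonneg _) h0, pi_norm_le_iff_of_nonneg (Real.sqrt_nonneg _)]
  intro i
  rw [Real.le_sqrt (norm_nonneg _) h0]
  exact Finset.single_le_sum (f := fun i => ‖e i‖ ^ 2) (fun i _ => by positivity)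
    (Finset.mem_univ i)

/-! ### Perturbed processes and the derivative of their cost -/

namespace Data

variable (P : Data n m d)

theorem isClosed_C : IsClosed P.C := by
  have : P.C = ⋂ i, {x | ⟪P.gen i, x⟫ ≤ 0} := by ext; simp [C]
  rw [this]
  exact isClosed_iInter fun i => isClosed_le (by fun_prop) continuous_const

theorem isClosed_gph_F (hf : Continuous fun q : Vec n × Vec d => P.f q.1 q.2) :
    IsClosed (gph P.F) := by
  have hfst : Continuous fun q : EProd (State n d) (Vec n) => q.fst := WithLp.fstL 2 ℝ _ _ |>.continuous
  have hsnd : Continuous fun q : EProd (State n d) (Vec n) => q.snd := WithLp.sndL 2 ℝ _ _ |>.continuous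
  have : gph P.F = (fun q : EProd (State n d) (Vec n) => (xc q.fst - uc q.fst,
      q.snd - P.f (xc q.fst) (ac q.fst))) ⁻¹' {q | q.2 ∈ convexNormalCone q.1 P.C} := by
    ext q
    constructor
    · rintro ⟨v, hv, hq⟩
      simpa [hq] using hv
    · intro hq
      exact ⟨_, hq, by simp⟩
  rw [this]
  refine (isClosed_convexNormalCone_graph P.isClosed_C).preimage ?_
  exact ((continuous_xc.comp hfst).sub (continuous_uc.comp hfst)).prodMk (hsnd.sub
    (hf.comp ((continuous_xc.comp hfst).prodMk (continuous_ac.comp hfst))))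

/-- The process `z` with the nodes `1, …, k` perturbed by `e`. -/
noncomputable def perturb (z : ℕ → State n d) (e : Fin P.k → State n d) (j : ℕ) : State n d :=
  z j + shift P.k j e

/-- The perturbation of the discrete velocity. -/
noncomputable def velShift (j : ℕ) : (Fin P.k → State n d) →L[ℝ] State n d :=
  P.h⁻¹ • (shift P.k (j + 1) - shift P.k j)

@[simp] theorem perturb_zero (z : ℕ → State n d) : P.perturb z 0 = z := by
  funext j; simp [perturb]

theorem vel_perturb (z : ℕ → State n d) (e : Fin P.k → State n d) (j : ℕ) :
    P.vel (P.perturb z e) j = P.vel z j + P.velShift j e := by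
  simp only [vel, perturb, velShift, smul_apply, sub_apply, ← smul_add]
  congr 1
  abel

theorem hasFDerivAt_perturb (z : ℕ → State n d) (e : Fin P.k → State n d) (j : ℕ) :
    HasFDerivAt (fun e => P.perturb z e j) (shift P.k j) e := by
  have := ((shift P.k j).hasFDerivAt (x := e)).const_add (z j)
  exact this

theorem hasFDerivAt_vel_perturb (z : ℕ → State n d) (e : Fin P.k → State n d) (j : ℕ) :
    HasFDerivAt (fun e => P.vel (P.perturb z e) j) (P.velShift j) e := by
  simp only [vel_perturb]
  exact (P.velShift j).hasFDerivAt.const_add _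

theorem continuous_perturb (z : ℕ → State n d) (j : ℕ) :
    Continuous fun e => P.perturb z e j :=
  continuous_const.add (shift P.k j).continuous

theorem continuous_vel_perturb (z : ℕ → State n d) (j : ℕ) :
    Continuous fun e => P.vel (P.perturb z e) j := by
  simp only [vel_perturb]
  exact continuous_const.add (P.velShift j).continuous

variable {P}

theorem h_pos (hT : 0 < P.T) (hk : 1 ≤ P.k) : 0 < P.h :=
  div_pos hT (by exact_mod_cast hk)

theorem t_succ_sub (j : ℕ) : P.t (j + 1) - P.t j = P.h := by
  simp only [t]; push_cast; ring

theorem intervalIntegrable_of_mem_mesh {F : Type*} [NormedAddCommGroup F] {g : ℝ → F}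
    (hT : 0 < P.T) (hk : 1 ≤ P.k) (hg : Integrable g (volume.restrict (Set.Icc 0 P.T)))
    {j : ℕ} (hj : j < P.k) : IntervalIntegrable g volume (P.t j) (P.t (j + 1)) := by
  have hh := h_pos hT hk
  have h1 : P.t j ≤ P.t (j + 1) := by linarith [P.t_succ_sub j]
  rw [intervalIntegrable_iff_integrableOn_Ioc_of_le h1]
  refine IntegrableOn.mono_set hg fun s hs => ⟨?_, ?_⟩
  · exact (mul_nonneg (Nat.cast_nonneg j) hh.le).trans hs.1.le
  · refine hs.2.trans ?_
    have h2 : ((j + 1 : ℕ) : ℝ) ≤ P.k := by exact_mod_cast hj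
    have h3 : (P.k : ℝ) * P.h = P.T := by
      have : (P.k : ℝ) ≠ 0 := by positivity
      simp only [h]; field_simp
    calc P.t (j + 1) = ((j + 1 : ℕ) : ℝ) * P.h := rfl
      _ ≤ P.k * P.h := mul_le_mul_of_nonneg_right h2 hh.le
      _ = P.T := h3

theorem θ_eq (hT : 0 < P.T) (hk : 1 ≤ P.k)
    (hL2 : MemLp (deriv P.zbar) 2 (volume.restrict (Set.Icc 0 P.T)))
    (z : ℕ → State n d) {j : ℕ} (hj : j < P.k) :
    P.θ z j = (2 : ℝ) • (P.h • P.vel z j - ∫ s in (P.t j)..(P.t (j + 1)), deriv P.zbar s) := by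
  have hi := intervalIntegrable_of_mem_mesh hT hk (hL2.integrable (by norm_num)) hj
  unfold θ
  rw [intervalIntegral.integral_sub intervalIntegrable_const hi,
    intervalIntegral.integral_const, t_succ_sub]

/-- `θ j` is the gradient of the `j`-th integral with respect to the `j`-th discrete velocity. -/
theorem hasFDerivAt_velocityGap_perturb (hT : 0 < P.T) (hk : 1 ≤ P.k)
    (hL2 : MemLp (deriv P.zbar) 2 (volume.restrict (Set.Icc 0 P.T)))
    (z : ℕ → State n d) (e : Fin P.k → State n d) :
    HasFDerivAt (fun e => P.velocityGap (P.perturb z e))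
      (∑ j ∈ Finset.range P.k, innerSL ℝ (P.θ (P.perturb z e) j) ∘L P.velShift j) e := by
  refine HasFDerivAt.fun_sum fun j hj => ?_
  have hj := Finset.mem_range.1 hj
  have hi := intervalIntegrable_of_mem_mesh hT hk (hL2.integrable (by norm_num)) hj
  obtain ⟨c, hc⟩ := exists_integral_norm_sub_sq_eq hi (intervalIntegrable_of_mem_mesh hT hk
    (MemLp.integrable_norm_pow (p := 2) (by exact_mod_cast hL2) two_ne_zero) hj)
  simp only [hc, t_succ_sub]
  have hv := P.hasFDerivAt_vel_perturb z e j
  have hd := ((hv.norm_sq.const_mul P.h).sub ((hv.inner ℝ (hasFDerivAt_const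
    (∫ s in (P.t j)..(P.t (j + 1)), deriv P.zbar s) e)).const_mul 2)).add_const c
  refine hd.congr_fderiv ?_
  ext δ
  rw [θ_eq hT hk hL2 _ hj]
  simp [real_inner_comm]
  ring

theorem continuous_θ_perturb (hT : 0 < P.T) (hk : 1 ≤ P.k)
    (hL2 : MemLp (deriv P.zbar) 2 (volume.restrict (Set.Icc 0 P.T)))
    (z : ℕ → State n d) {j : ℕ} (hj : j < P.k) :
    Continuous fun e => P.θ (P.perturb z e) j := by
  simp only [θ_eq hT hk hL2 _ hj]
  exact (((P.continuous_vel_perturb z j).const_smul P.h).sub continuous_const).const_smul (2 : ℝ)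

/-- At `z` both arguments are at most `μ` and they grow at most linearly in `e`, so the squared
distances are of second order. This is why the penalties leave no term in the optimality conditions.
-/
theorem exists_penalty_bound (z : ℕ → State n d) (hu : ‖uc (P.vel z 0)‖ ≤ P.μ)
    (hvar : P.uVariation z ≤ P.μ) :
    ∃ M : ℝ, ∀ e, Metric.infDist ‖uc (P.vel (P.perturb z e) 0)‖ (Set.Iic P.μ) ^ 2
        + Metric.infDist (P.uVariation (P.perturb z e)) (Set.Iic P.μ) ^ 2
      ≤ M * ∑ i, ‖e i‖ ^ 2 := by
  set L₁ := ‖ucL ∘L P.velShift 0‖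
  let D : ℕ → ((Fin P.k → State n d) →L[ℝ] Vec n) := fun j => P.h⁻¹ • (ucL ∘L shift P.k (j + 2)
    - (2 : ℝ) • (ucL ∘L shift P.k (j + 1)) + ucL ∘L shift P.k j)
  set L₂ := ∑ j ∈ Finset.range (P.k - 1), ‖D j‖
  have hL₂ : 0 ≤ L₂ := by positivity
  refine ⟨L₁ ^ 2 + L₂ ^ 2, fun e => ?_⟩
  have h1 : Metric.infDist ‖uc (P.vel (P.perturb z e) 0)‖ (Set.Iic P.μ) ≤ L₁ * ‖e‖ := by
    refine infDist_Iic_le (by positivity) ?_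
    rw [vel_perturb]
    calc ‖uc (P.vel z 0) + (ucL ∘L P.velShift 0) e‖ ≤ _ := norm_add_le _ _
      _ ≤ P.μ + L₁ * ‖e‖ := add_le_add hu (ContinuousLinearMap.le_opNorm _ _)
  have h2 : Metric.infDist (P.uVariation (P.perturb z e)) (Set.Iic P.μ) ≤ L₂ * ‖e‖ := by
    refine infDist_Iic_le (by positivity) ?_
    calc P.uVariation (P.perturb z e) ≤ P.uVariation z + L₂ * ‖e‖ := by
          simp only [uVariation, L₂, Finset.sum_mul, ← Finset.sum_add_distrib]
          refine Finset.sum_le_sum fun j _ => ?_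
          have : P.h⁻¹ • (uc (P.perturb z e (j + 2)) - (2 : ℝ) • uc (P.perturb z e (j + 1))
              + uc (P.perturb z e j)) = P.h⁻¹ • (uc (z (j + 2)) - (2 : ℝ) • uc (z (j + 1))
              + uc (z j)) + D j e := by
            change P.h⁻¹ • (uc (z (j + 2)) + uc (shift P.k (j + 2) e)
              - (2 : ℝ) • (uc (z (j + 1)) + uc (shift P.k (j + 1) e))
              + (uc (z j) + uc (shift P.k j e))) = P.h⁻¹ • (uc (z (j + 2))
              - (2 : ℝ) • uc (z (j + 1)) + uc (z j)) + P.h⁻¹ • (uc (shift P.k (j + 2) e)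
              - (2 : ℝ) • uc (shift P.k (j + 1) e) + uc (shift P.k j e))
            module
          rw [this]
          exact (norm_add_le _ _).trans (by gcongr; exact ContinuousLinearMap.le_opNorm _ _)
      _ ≤ P.μ + L₂ * ‖e‖ := by linarith
  calc _ ≤ (L₁ * ‖e‖) ^ 2 + (L₂ * ‖e‖) ^ 2 := by
        gcongr <;> exact Metric.infDist_nonneg
    _ = (L₁ ^ 2 + L₂ ^ 2) * ‖e‖ ^ 2 := by ring
    _ ≤ _ := by gcongr; exact norm_sq_le_sum_norm_sq e

theorem cost_eq_coe {y : ℕ → State n d} {a : ℝ} {b : ℕ → ℝ} (ha : P.φ (xc (y P.k)) = a)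
    (hb : ∀ j < P.k, P.ℓ (P.t j) (pair (y j) (P.vel y j)) = b j) :
    P.cost y = ((a + P.h * ∑ j ∈ Finset.range P.k, b j
      + (‖xc (P.vel y 0) - P.xdot0‖ ^ 2 + P.velocityGap y
        + Metric.infDist ‖uc (P.vel y 0)‖ (Set.Iic P.μ) ^ 2
        + Metric.infDist (P.uVariation y) (Set.Iic P.μ) ^ 2) : ℝ) : EReal) := by
  rw [cost, ha, Finset.sum_congr rfl fun j hj => hb j (Finset.mem_range.1 hj),
    EReal.coe_add _ (_ + _), EReal.coe_add a, EReal.coe_mul, coe_sum_ereal]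

end Data

/-- The extension of a finite sequence by zero. -/
noncomputable def extendZero {X : Type*} [Zero X] {k : ℕ} (f : Fin k → X) (j : ℕ) : X :=
  if hj : j < k then f ⟨j, hj⟩ else 0

@[simp] theorem extendZero_val {X : Type*} [Zero X] {k : ℕ} (f : Fin k → X) (i : Fin k) :
    extendZero f i = f i := by
  simp [extendZero]

theorem extendZero_of_lt {X : Type*} [Zero X] {k : ℕ} (f : Fin k → X) {j : ℕ} (hj : j < k) :
    extendZero f j = f ⟨j, hj⟩ := by
  simp [extendZero, hj]

/-! ### Norm constraints, feasibility and the smooth cost -/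

namespace Data

variable (P : Data n m d)

open Classical in
/-- The lower bound for the square of the norm of `u` at the node `j`. -/
noncomputable def normSqLower (j : ℕ) : ℝ :=
  if P.MiddleNode j then P.r ^ 2
  -- A negative lower bound on the norm is vacuous. The value `-1` keeps it inactive even at `u =
  -- 0`; with `0` the multiplier could have the wrong sign there.
  else if 0 ≤ P.r - P.τ - P.εk then (P.r - P.τ - P.εk) ^ 2 else -1

open Classical in
/-- The upper bound for the square of the norm of `u` at the node `j`. -/
noncomputable def normSqUpper (j : ℕ) : ℝ :=
  if P.MiddleNode j then P.r ^ 2 else (P.r + P.τ + P.εk) ^ 2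

variable {P}

theorem norm_sq_mem_Icc_iff_of_middle (hr : 0 < P.r) {j : ℕ} (hj : P.MiddleNode j) (u : Vec n) :
    ‖u‖ ^ 2 ∈ Set.Icc (P.normSqLower j) (P.normSqUpper j) ↔ ‖u‖ = P.r := by
  rw [normSqLower, normSqUpper, if_pos hj, if_pos hj, Set.Icc_self, Set.mem_singleton_iff]
  exact pow_left_inj₀ (norm_nonneg _) hr.le two_ne_zero

theorem norm_sq_mem_Icc_iff_of_not_middle (hb : 0 ≤ P.r + P.τ + P.εk) {j : ℕ}
    (hj : ¬P.MiddleNode j) (u : Vec n) :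
    ‖u‖ ^ 2 ∈ Set.Icc (P.normSqLower j) (P.normSqUpper j) ↔
      P.r - P.τ - P.εk ≤ ‖u‖ ∧ ‖u‖ ≤ P.r + P.τ + P.εk := by
  rw [normSqLower, normSqUpper, if_neg hj, if_neg hj, Set.mem_Icc,
    pow_le_pow_iff_left₀ (norm_nonneg _) hb two_ne_zero]
  refine and_congr_left fun _ => ?_
  split_ifs with ha
  · exact pow_le_pow_iff_left₀ ha (norm_nonneg _) two_ne_zero
  · have := norm_nonneg u
    exact ⟨fun _ => by linarith, fun _ => by linarith [sq_nonneg ‖u‖]⟩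

/-- For `ν ≥ 0`, `ν ^ 2 - ‖u‖ ^ 2` is `ν - ‖u‖` times the nonnegative `ν + ‖u‖`. A negative `ν`
occurs only with the lower bound `-1`, which forces `ξ ≥ 0`. -/
theorem mul_sub_norm_le_zero {j : ℕ} (hj : ¬P.MiddleNode j) {ξ : ℝ} {u : Vec n}
    (hξ : ∀ ν ∈ Set.Icc (P.normSqLower j) (P.normSqUpper j), ξ * (ν - ‖u‖ ^ 2) ≤ 0)
    {ν : ℝ}
    (hν : ν ∈ Set.Icc (P.r - P.τ - P.εk) (P.r + P.τ + P.εk)) : ξ * (ν - ‖u‖) ≤ 0 := by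
  rw [normSqLower, normSqUpper, if_neg hj, if_neg hj] at hξ
  have hu := norm_nonneg u
  rcases le_or_gt 0 ν with h0 | h0
  · have h1 := hξ (ν ^ 2) ⟨by
      split_ifs with ha
      · exact pow_le_pow_left₀ ha hν.1 2
      · linarith [sq_nonneg ν], pow_le_pow_left₀ h0 hν.2 2⟩
    rcases (add_nonneg h0 hu).eq_or_lt with h2 | h2
    · have h3 : ν = 0 := by linarith
      have h4 : ‖u‖ = 0 := by linarith
      simp [h3, h4]
    · by_contra! h3
      nlinarith [mul_pos h3 h2]
  · have ha : ¬0 ≤ P.r - P.τ - P.εk := by linarith [hν.1]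
    rw [if_neg ha] at hξ
    have h1 := hξ (-1) ⟨le_rfl, by linarith [sq_nonneg (P.r + P.τ + P.εk)]⟩
    have h2 : 0 ≤ ξ := by
      by_contra! h3
      nlinarith [sq_nonneg ‖u‖]
    exact mul_nonpos_of_nonneg_of_nonpos h2 (by linarith)

theorem continuous_velocityGap_perturb (hT : 0 < P.T) (hk : 1 ≤ P.k)
    (hL2 : MemLp (deriv P.zbar) 2 (volume.restrict (Set.Icc 0 P.T))) (z : ℕ → State n d) :
    Continuous fun e => P.velocityGap (P.perturb z e) :=
  continuous_iff_continuousAt.2 fun e =>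
    (hasFDerivAt_velocityGap_perturb hT hk hL2 z e).continuousAt

/-- Small perturbations that satisfy the dynamics and the state constraints are feasible. -/
theorem eventually_feasible_perturb (hT : 0 < P.T) (hk : 1 ≤ P.k) (hr : 0 < P.r)
    (hb : 0 ≤ P.r + P.τ + P.εk)
    (hL2 : MemLp (deriv P.zbar) 2 (volume.restrict (Set.Icc 0 P.T)))
    {z : ℕ → State n d} (hz : P.Feasible z)
    (hnear : ∀ j < P.k, ‖z j - P.zbar (P.t j)‖ < P.ε / 2)
    (hvel : P.velocityGap z < P.ε / 2) (hu : ‖uc (P.vel z 0)‖ ≤ P.μ)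
    (hvar : P.uVariation z ≤ P.μ) :
    ∀ᶠ e in 𝓝 (0 : Fin P.k → State n d),
      (∀ j < P.k, pair (P.perturb z e j) (-xc (P.vel (P.perturb z e) j)) ∈ gph P.F) →
      (∀ i, ⟪P.gen i, xc (P.perturb z e P.k) - uc (P.perturb z e P.k)⟫ ≤ 0) →
      (∀ j < P.k, ‖uc (P.perturb z e (j + 1))‖ ^ 2 ∈
        Set.Icc (P.normSqLower (j + 1)) (P.normSqUpper (j + 1))) →
      P.Feasible (P.perturb z e) := by
  have hu' : ∀ j, Continuous fun e => uc (P.perturb z e j) := fun j =>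
    continuous_uc.comp (P.continuous_perturb z j)
  have e1 : ∀ᶠ e in 𝓝 (0 : Fin P.k → State n d), ∀ j ∈ Set.Iio P.k,
      ‖P.perturb z e j - P.zbar (P.t j)‖ < P.ε / 2 := by
    refine (eventually_all_finite (Set.finite_Iio _)).2 fun j hj => ?_
    refine (((P.continuous_perturb z j).sub continuous_const).norm.tendsto 0).eventually_lt_const ?_
    simpa using hnear j hj
  have e2 : ∀ᶠ e in 𝓝 (0 : Fin P.k → State n d), P.velocityGap (P.perturb z e) < P.ε / 2 :=
    ((continuous_velocityGap_perturb hT hk hL2 z).tendsto 0).eventually_lt_const (by simpa using hvel)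
  have e3 : ∀ᶠ e in 𝓝 (0 : Fin P.k → State n d), ‖uc (P.vel (P.perturb z e) 0)‖ < P.μ + 1 :=
    ((continuous_uc.comp (P.continuous_vel_perturb z 0)).norm.tendsto 0).eventually_lt_const
      (by simpa using hu.trans_lt (lt_add_one _))
  have e4 : ∀ᶠ e in 𝓝 (0 : Fin P.k → State n d), P.uVariation (P.perturb z e) < P.μ + 1 := by
    have hc : Continuous fun e : Fin P.k → State n d => P.uVariation (P.perturb z e) :=
      continuous_finsetSum _ fun j _ => ((((hu' (j + 2)).sub ((hu' (j + 1)).const_smul (2 : ℝ))).add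
        (hu' j)).const_smul P.h⁻¹).norm
    exact (hc.tendsto 0).eventually_lt_const (by simpa using hvar.trans_lt (lt_add_one _))
  filter_upwards [e1, e2, e3, e4] with e h1 h2 h3 h4 hdyn hter hnorm
  -- Node 0 does not move, so its constraints are inherited from `z`.
  have h0 : P.perturb z e 0 = z 0 := by simp [perturb]
  have hh := h_pos hT hk
  refine ⟨h0.trans hz.initial, fun j hj => ⟨_, hdyn j hj, ?_⟩, hter, fun j hj hm => ?_,
    fun j hj hm => ?_, fun j hj => (h1 j hj).le, h2.le, h3.le, h4.le⟩
  · change xc (P.perturb z e (j + 1)) = xc (P.perturb z e j) - P.h • -(P.h⁻¹ •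
      (xc (P.perturb z e (j + 1)) - xc (P.perturb z e j)))
    rw [smul_neg, smul_smul, mul_inv_cancel₀ hh.ne', one_smul]
    abel
  · cases j with
    | zero => rw [h0]; exact hz.norm_middle 0 hj hm
    | succ j => exact (norm_sq_mem_Icc_iff_of_middle hr hm _).1 (hnorm j hj)
  · cases j with
    | zero => rw [h0]; exact hz.norm_end 0 hj hm
    | succ j => exact (norm_sq_mem_Icc_iff_of_not_middle hb hm _).1 (hnorm j hj)

/-- The smooth part of the cost of a perturbed process, with a quadratic term that dominates the
penalties on the velocity of the `u`-component. -/
noncomputable def smoothCost (P : Data n m d) (M : ℝ) (z : ℕ → State n d)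
    (e : Fin P.k → State n d) : ℝ :=
  ‖xc (P.vel (P.perturb z e) 0) - P.xdot0‖ ^ 2 + P.velocityGap (P.perturb z e)
    + M * ∑ i, ‖e i‖ ^ 2

/-- The derivative of `smoothCost`. -/
noncomputable def smoothCostDeriv (P : Data n m d) (M : ℝ) (z : ℕ → State n d)
    (e : Fin P.k → State n d) : (Fin P.k → State n d) →L[ℝ] ℝ :=
  2 • (innerSL ℝ (xc (P.vel (P.perturb z e) 0) - P.xdot0) ∘L (xcL ∘L P.velShift 0))
    + ∑ j ∈ Finset.range P.k, innerSL ℝ (P.θ (P.perturb z e) j) ∘L P.velShift j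
    + M • ∑ i, 2 • (innerSL ℝ (e i) ∘L ContinuousLinearMap.proj i)

theorem hasFDerivAt_smoothCost (hT : 0 < P.T) (hk : 1 ≤ P.k)
    (hL2 : MemLp (deriv P.zbar) 2 (volume.restrict (Set.Icc 0 P.T))) (M : ℝ)
    (z : ℕ → State n d) (e : Fin P.k → State n d) :
    HasFDerivAt (P.smoothCost M z) (P.smoothCostDeriv M z e) e := by
  have h1 := ((xcL.hasFDerivAt.comp e (P.hasFDerivAt_vel_perturb z e 0)).sub_const P.xdot0).norm_sq
  have h2 := hasFDerivAt_velocityGap_perturb hT hk hL2 z e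
  have h3 := (HasFDerivAt.fun_sum fun i (_ : i ∈ (Finset.univ : Finset (Fin P.k))) =>
    (hasFDerivAt_apply (𝕜 := ℝ) i e).norm_sq).const_mul M
  exact (h1.add h2).add h3

theorem continuous_smoothCostDeriv (hT : 0 < P.T) (hk : 1 ≤ P.k)
    (hL2 : MemLp (deriv P.zbar) 2 (volume.restrict (Set.Icc 0 P.T))) (M : ℝ)
    (z : ℕ → State n d) : Continuous (P.smoothCostDeriv M z) := by
  refine ((Continuous.const_smul ?_ 2).add (continuous_finsetSum _ fun j hj => ?_)).add
    (Continuous.const_smul (continuous_finsetSum _ fun i _ => Continuous.const_smul ?_ 2) M)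
  · exact ((innerSL ℝ).continuous.comp ((continuous_xc.comp
      (P.continuous_vel_perturb z 0)).sub continuous_const)).clm_comp continuous_const
  · exact ((innerSL ℝ).continuous.comp (continuous_θ_perturb hT hk hL2 z
      (Finset.mem_range.1 hj))).clm_comp continuous_const
  · exact ((innerSL ℝ).continuous.comp (continuous_apply i)).clm_comp continuous_const

end Data

/-! ### Optimality as strict local minimality, and stationarity -/

namespace Data

variable {P : Data n m d}

/-- An optimal process is a strict local minimizer, among the perturbations that satisfy the
dynamics and the state constraints, of the cost with `smoothCost` in place of its smooth terms. -/
theorem IsOptimal.eventually_lt (hT : 0 < P.T) (hk : 1 ≤ P.k) (hr : 0 < P.r)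
    (hb : 0 ≤ P.r + P.τ + P.εk)
    (hL2 : MemLp (deriv P.zbar) 2 (volume.restrict (Set.Icc 0 P.T)))
    {z : ℕ → State n d} (hz : P.IsOptimal z)
    (hnear : ∀ j < P.k, ‖z j - P.zbar (P.t j)‖ < P.ε / 2)
    (hvel : P.velocityGap z < P.ε / 2) (hu : ‖uc (P.vel z 0)‖ ≤ P.μ)
    (hvar : P.uVariation z ≤ P.μ)
    {g₀ : Vec n → ℝ} {U₀ : Set (Vec n)} (hU₀ : U₀ ∈ 𝓝 (xc (z P.k)))
    (hg₀ : ∀ y ∈ U₀, P.φ y = (g₀ y : EReal))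
    {g : ℕ → EProd (State n d) (State n d) → ℝ} {U : ℕ → Set (EProd (State n d) (State n d))}
    (hU : ∀ j < P.k, U j ∈ 𝓝 (pair (z j) (P.vel z j)))
    (hg : ∀ j < P.k, ∀ y ∈ U j, P.ℓ (P.t j) y = (g j y : EReal)) :
    ∃ M, ∀ᶠ e in 𝓝 (0 : Fin P.k → State n d),
      (∀ j < P.k, pair (P.perturb z e j) (-xc (P.vel (P.perturb z e) j)) ∈ gph P.F) →
      (∀ i, ⟪P.gen i, xc (P.perturb z e P.k) - uc (P.perturb z e P.k)⟫ ≤ 0) →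
      (∀ j < P.k, ‖uc (P.perturb z e (j + 1))‖ ^ 2 ∈
        Set.Icc (P.normSqLower (j + 1)) (P.normSqUpper (j + 1))) → e ≠ 0 →
      g₀ (xc (z P.k)) + ∑ j ∈ Finset.range P.k, P.h * g j (pair (z j) (P.vel z j))
          + P.smoothCost M z 0
        < g₀ (xc (P.perturb z e P.k)) + ∑ j ∈ Finset.range P.k,
          P.h * g j (pair (P.perturb z e j) (P.vel (P.perturb z e) j)) + P.smoothCost M z e := by
  obtain ⟨M, hM⟩ := exists_penalty_bound z hu hvar
  have e1 : ∀ᶠ e in 𝓝 (0 : Fin P.k → State n d), xc (P.perturb z e P.k) ∈ U₀ :=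
    ((continuous_xc.comp (P.continuous_perturb z P.k)).tendsto 0).eventually_mem (by simpa using hU₀)
  have hpair : ∀ j, Continuous fun e => pair (P.perturb z e j) (P.vel (P.perturb z e) j) :=
    fun j => (WithLp.prod_continuous_toLp 2 _ _).comp
      ((P.continuous_perturb z j).prodMk (P.continuous_vel_perturb z j))
  have e2 : ∀ᶠ e in 𝓝 (0 : Fin P.k → State n d), ∀ j ∈ Set.Iio P.k,
      pair (P.perturb z e j) (P.vel (P.perturb z e) j) ∈ U j :=
    (eventually_all_finite (Set.finite_Iio _)).2 fun j hj =>
      ((hpair j).tendsto 0).eventually_mem (by simpa using hU j hj)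
  -- `M` dominates the penalties; the extra 1 makes the minimum strict.
  refine ⟨M + 1, ?_⟩
  filter_upwards [e1, e2, eventually_feasible_perturb hT hk hr hb hL2 hz.1 hnear hvel hu hvar]
    with e h1 h2 h3 hdyn hter hnorm hne
  have h4 := hz.2 _ (h3 hdyn hter hnorm)
  rw [cost_eq_coe (hg₀ _ (mem_of_mem_nhds hU₀))
      (fun j hj => hg j hj _ (mem_of_mem_nhds (hU j hj))),
    cost_eq_coe (hg₀ _ h1) (fun j hj => hg j hj _ (h2 j hj)), EReal.coe_le_coe_iff,
    Metric.infDist_zero_of_mem (Set.mem_Iic.2 hu),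
    Metric.infDist_zero_of_mem (Set.mem_Iic.2 hvar)] at h4
  have h5 := hM e
  have h6 : 0 < ∑ i, ‖e i‖ ^ 2 := by
    have h7 : 0 < ‖e‖ := norm_pos_iff.2 hne
    exact (by positivity : 0 < ‖e‖ ^ 2).trans_le (norm_sq_le_sum_norm_sq e)
  simp only [← Finset.mul_sum, smoothCost, perturb_zero, Pi.zero_apply, norm_zero]
  simp only [ne_eq, OfNat.ofNat_ne_zero, not_false_eq_true, zero_pow, Finset.sum_const_zero,
    mul_zero, add_zero] at h4 ⊢
  linarith

theorem hasFDerivAt_inner_gen (z : ℕ → State n d) (i : Fin m) (e : Fin P.k → State n d) :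
    HasFDerivAt (fun e => ⟪P.gen i, xc (P.perturb z e P.k) - uc (P.perturb z e P.k)⟫)
      (innerSL ℝ (P.gen i) ∘L ((xcL - ucL) ∘L shift P.k P.k)) e :=
  (innerSL ℝ (P.gen i)).hasFDerivAt.comp e
    ((xcL - ucL).hasFDerivAt.comp e (P.hasFDerivAt_perturb z e P.k))

theorem hasFDerivAt_norm_sq_uc (z : ℕ → State n d) (j : ℕ) (e : Fin P.k → State n d) :
    HasFDerivAt (fun e => ‖uc (P.perturb z e j)‖ ^ 2)
      (2 • (innerSL ℝ (uc (P.perturb z e j)) ∘L (ucL ∘L shift P.k j))) e :=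
  (ucL.hasFDerivAt.comp e (P.hasFDerivAt_perturb z e j)).norm_sq

/-- The stationarity condition for an optimal process, in terms of all perturbations. -/
theorem IsOptimal.exists_stationary_multipliers (hT : 0 < P.T) (hk : 1 ≤ P.k) (hr : 0 < P.r)
    (hb : 0 ≤ P.r + P.τ + P.εk)
    (hf : Continuous fun q : Vec n × Vec d => P.f q.1 q.2)
    (hL2 : MemLp (deriv P.zbar) 2 (volume.restrict (Set.Icc 0 P.T)))
    {z : ℕ → State n d} (hz : P.IsOptimal z)
    (hφL : LocallyLipschitzAround P.φ (xc (z P.k)))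
    (hℓL : ∀ j < P.k, LocallyLipschitzAround (P.ℓ (P.t j)) (pair (z j) (P.vel z j)))
    (hnear : ∀ j < P.k, ‖z j - P.zbar (P.t j)‖ < P.ε / 2)
    (hvel : P.velocityGap z < P.ε / 2) (hu : ‖uc (P.vel z 0)‖ ≤ P.μ)
    (hvar : P.uVariation z ≤ P.μ) :
    ∃ (lam : ℝ) (ϑ : Vec n) (s : Fin P.k → EProd (State n d) (State n d))
      (η : Fin P.k → EProd (State n d) (Vec n)) (α : Fin m → ℝ) (ξ : Fin P.k → ℝ),
      0 ≤ lam ∧ lam + (∑ j, ‖η j‖ + (∑ i, ‖α i‖ + ∑ j, ‖ξ j‖)) = 1 ∧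
      ϑ ∈ subdiff P.φ (xc (z P.k)) ∧
      (∀ j : Fin P.k, s j ∈ subdiff (P.ℓ (P.t j)) (pair (z j) (P.vel z j))) ∧
      (∀ j : Fin P.k, η j ∈ limitingNormalCone (pair (z j) (-xc (P.vel z j))) (gph P.F)) ∧
      (∀ i, α i ∈ limitingNormalCone ⟪P.gen i, xc (z P.k) - uc (z P.k)⟫ (Set.Iic 0)) ∧
      (∀ j : Fin P.k, ξ j ∈ limitingNormalCone (‖uc (z (j + 1))‖ ^ 2)
        (Set.Icc (P.normSqLower (j + 1)) (P.normSqUpper (j + 1)))) ∧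
      ∀ δ : Fin P.k → State n d,
        lam * (⟪ϑ, xc (shift P.k P.k δ)⟫
          + ∑ j : Fin P.k, P.h * ⟪s j, pair (shift P.k j δ) (P.velShift j δ)⟫
          + (2 * ⟪xc (P.vel z 0) - P.xdot0, xc (P.velShift 0 δ)⟫
            + ∑ j : Fin P.k, ⟪P.θ z j, P.velShift j δ⟫))
        + (∑ j : Fin P.k, ⟪η j, pair (shift P.k j δ) (-xc (P.velShift j δ))⟫
          + (∑ i, α i * ⟪P.gen i, xc (shift P.k P.k δ) - uc (shift P.k P.k δ)⟫
            + ∑ j : Fin P.k, ξ j * (2 * ⟪uc (z (j + 1)), uc (shift P.k (j + 1) δ)⟫))) = 0 := by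
  have hh := h_pos hT hk
  obtain ⟨g₀, K₀, U₀, hU₀, hLip₀, hg₀⟩ := hφL
  -- The guard `j < P.k` sits inside the existential so that the choices are functions on all of
  -- `ℕ`.
  have hℓ' : ∀ j, ∃ (g : EProd (State n d) (State n d) → ℝ) (K : NNReal)
      (U : Set (EProd (State n d) (State n d))), j < P.k → U ∈ 𝓝 (pair (z j) (P.vel z j)) ∧
        LipschitzOnWith K g U ∧ ∀ y ∈ U, P.ℓ (P.t j) y = ((g y : ℝ) : EReal) := by
    intro j
    by_cases hj : j < P.k
    · obtain ⟨g, K, U, hU, hg⟩ := hℓL j hj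
      exact ⟨g, K, U, fun _ => ⟨hU, hg⟩⟩
    · exact ⟨0, 0, ∅, fun h => absurd h hj⟩
  choose g K U hU using hℓ'
  obtain ⟨M, hmin⟩ := hz.eventually_lt hT hk hr hb hL2 hnear hvel hu hvar hU₀ hg₀
    (fun j hj => (hU j hj).1) (fun j hj => (hU j hj).2.2)
  have hz0 := P.perturb_zero z
  have hA₂ : ∀ (j : Fin P.k) (e : Fin P.k → State n d), HasFDerivAt
      (fun e => pair (P.perturb z e j) (P.vel (P.perturb z e) j))
      (pairL (shift P.k j) (P.velShift j)) e := fun j e =>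
    hasFDerivAt_pair (P.hasFDerivAt_perturb z e j) (P.hasFDerivAt_vel_perturb z e j)
  have hB₁ : ∀ (j : Fin P.k) (e : Fin P.k → State n d), HasFDerivAt
      (fun e => pair (P.perturb z e j) (-xc (P.vel (P.perturb z e) j)))
      (pairL (shift P.k j) (-(xcL ∘L P.velShift j))) e := fun j e =>
    hasFDerivAt_pair (P.hasFDerivAt_perturb z e j)
      (xcL.hasFDerivAt.comp e (P.hasFDerivAt_vel_perturb z e j)).neg
  obtain ⟨lam, v₁, v₂, η₁, η₂, hlam, hsum, hv₁, hv₂, hη₁, hη₂, hstat⟩ :=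
    exists_limiting_multipliers_sum (E := Fin P.k → State n d) (ι₁ := Unit) (ι₂ := Fin P.k)
    (κ₁ := Fin P.k) (κ₂ := Fin m ⊕ Fin P.k)
    (g₁ := fun _ => g₀) (A₁ := fun _ e => xc (P.perturb z e P.k))
    (A₁' := fun _ _ => xcL ∘L shift P.k P.k)
    (g₂ := fun j y => P.h * g j y)
    (A₂ := fun j e => pair (P.perturb z e j) (P.vel (P.perturb z e) j))
    (A₂' := fun j _ => pairL (shift P.k j) (P.velShift j))
    (B₁ := fun j e => pair (P.perturb z e j) (-xc (P.vel (P.perturb z e) j)))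
    (B₁' := fun j _ => pairL (shift P.k j) (-(xcL ∘L P.velShift j)))
    (Ω₁ := fun _ => gph P.F)
    (B₂ := Sum.elim
      (fun i e => ⟪P.gen i, xc (P.perturb z e P.k) - uc (P.perturb z e P.k)⟫)
      (fun j e => ‖uc (P.perturb z e (j + 1))‖ ^ 2))
    (B₂' := Sum.elim
      (fun i _ => innerSL ℝ (P.gen i) ∘L ((xcL - ucL) ∘L shift P.k P.k))
      (fun j e => 2 • (innerSL ℝ (uc (P.perturb z e (j + 1))) ∘L (ucL ∘L shift P.k (j + 1)))))
    (Ω₂ := Sum.elim (fun _ => Set.Iic 0)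
      (fun j => Set.Icc (P.normSqLower (j + 1)) (P.normSqUpper (j + 1))))
    (S := P.smoothCost M z) (S' := P.smoothCostDeriv M z) (z₀ := 0)
    (fun _ e => xcL.hasFDerivAt.comp e (P.hasFDerivAt_perturb z e P.k)) hA₂ hB₁
    (Sum.rec (fun i => hasFDerivAt_inner_gen z i)
      (fun j => hasFDerivAt_norm_sq_uc z (j + 1)))
    (hasFDerivAt_smoothCost hT hk hL2 M z)
    (fun _ => continuous_const) (fun _ => continuous_const) (fun _ => continuous_const)
    (Sum.rec (fun _ => continuous_const) fun j =>
      (((innerSL ℝ).continuous.comp (continuous_uc.comp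
        (P.continuous_perturb z (j + 1)))).clm_comp continuous_const).const_smul 2)
    (continuous_smoothCostDeriv hT hk hL2 M z)
    (fun _ => P.isClosed_gph_F hf) (Sum.rec (fun _ => isClosed_Iic) fun _ => isClosed_Icc)
    (fun j => by
      rw [hz0]
      obtain ⟨w, hw, hw'⟩ := hz.1.dynamics j j.2
      -- The dynamics with selection `w` says exactly that the negative velocity equals `w`.
      have : -xc (P.vel z j) = w := by
        change -(P.h⁻¹ • (xc (z (j + 1)) - xc (z j))) = w
        rw [hw', sub_sub_cancel_left, smul_neg, neg_neg, smul_smul, inv_mul_cancel₀ hh.ne', one_smul]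
      rw [this]
      exact hw)
    (Sum.rec (fun i => by simpa [hz0] using hz.1.terminal i) fun j => by
      simp only [Sum.elim_inr, hz0]
      by_cases hj : P.MiddleNode (j + 1)
      · exact (norm_sq_mem_Icc_iff_of_middle hr hj _).2 (hz.1.norm_middle _ j.2 hj)
      · exact (norm_sq_mem_Icc_iff_of_not_middle hb hj _).2 (hz.1.norm_end _ j.2 hj))
    (fun _ => ⟨K₀, U₀, by rwa [hz0], hLip₀⟩)
    (fun j => ⟨‖P.h‖₊ * K j, U j, by rw [hz0]; exact (hU j j.2).1,
      (lipschitzWith_smul P.h).comp_lipschitzOnWith (hU j j.2).2.1⟩)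
    (by
      filter_upwards [hmin] with e he h1 h2 h3
      have := he (fun j hj => h1 ⟨j, hj⟩) (fun i => h2 (Sum.inl i))
        (fun j hj => h2 (Sum.inr ⟨j, hj⟩)) h3
      simp only [Finset.sum_range] at this
      simpa only [Finset.univ_unique, Finset.sum_singleton, hz0] using this)
  simp only [hz0, Finset.univ_unique, Finset.sum_singleton, PUnit.default_eq_unit,
    Fintype.sum_sum_type] at hsum hv₁ hv₂ hη₁ hη₂ hstat
  refine ⟨lam, v₁ (), fun j => P.h⁻¹ • v₂ j, η₁, fun i => η₂ (Sum.inl i),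
    fun j => η₂ (Sum.inr j), hlam, hsum, (hv₁ ()).mem_subdiff hU₀ hLip₀.continuousOn hg₀,
    fun j => ((hv₂ j).of_const_mul hh).mem_subdiff (hU j j.2).1 (hU j j.2).2.1.continuousOn
      (hU j j.2).2.2, hη₁, fun i => by simpa [hz0] using hη₂ (Sum.inl i),
    fun j => by simpa only [Sum.elim_inr, hz0] using hη₂ (Sum.inr j), fun δ => ?_⟩
  refine Eq.trans ?_ (hstat δ)
  have hinner : ∀ a b : ℝ, ⟪a, b⟫ = a * b := fun a b => by simp [mul_comm]
  have hcancel : ∀ a : ℝ, P.h * (P.h⁻¹ * a) = a := fun a => mul_inv_cancel_left₀ hh.ne' a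
  -- The added quadratic term has zero derivative at `e = 0`, so `M` disappears.
  have hS : P.smoothCostDeriv M z 0 δ = 2 * ⟪xc (P.vel z 0) - P.xdot0, xc (P.velShift 0 δ)⟫
      + ∑ j : Fin P.k, ⟪P.θ z j, P.velShift j δ⟫ := by
    simp only [smoothCostDeriv, hz0, Finset.sum_range, add_apply, smul_apply, sum_apply,
      ContinuousLinearMap.comp_apply, innerSL_apply_apply, Pi.zero_apply, map_zero,
      ContinuousLinearMap.zero_comp, smul_zero, Finset.sum_const_zero, add_zero, xcL_apply,
      nsmul_eq_mul, Nat.cast_ofNat]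
  rw [hS]
  simp only [hinner, Sum.elim_inl, Sum.elim_inr, hz0, real_inner_smul_left, hcancel]
  simp only [ContinuousLinearMap.comp_apply, innerSL_apply_apply, smul_apply, sub_apply,
    neg_apply, pairL_apply, xcL_apply, ucL_apply, nsmul_eq_mul, Nat.cast_ofNat]

end Data

theorem State.ext {z z' : State n d} (hx : xc z = xc z') (hu : uc z = uc z') (ha : ac z = ac z') :
    z = z' :=
  (WithLp.equiv 2 _).injective (Prod.ext hx ((WithLp.equiv 2 _).injective (Prod.ext hu ha)))

theorem nonneg_and_mul_eq_zero_of_mem_limitingNormalCone_Iic {α s : ℝ} (hs : s ≤ 0)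
    (hα : α ∈ limitingNormalCone s (Set.Iic 0)) : 0 ≤ α ∧ α * s = 0 := by
  have h : ∀ y ≤ 0, α * (y - s) ≤ 0 := fun y hy => by
    have := inner_le_zero_of_mem_limitingNormalCone (convex_Iic 0) hα (Set.mem_Iic.2 hy)
    simpa [mul_comm] using this
  have h1 := h (s - 1) (by linarith)
  have h2 := h 0 le_rfl
  have h3 : 0 ≤ α := by linarith
  exact ⟨h3, le_antisymm (mul_nonpos_of_nonneg_of_nonpos h3 hs) (by linarith)⟩

/-! ### Adjoint variables and node equations -/

namespace Data

variable {P : Data n m d}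

/-- The stationarity condition of an optimal process, node by node. -/
theorem IsOptimal.exists_node_multipliers (hT : 0 < P.T) (hk : 1 ≤ P.k) (hr : 0 < P.r)
    (hb : 0 ≤ P.r + P.τ + P.εk)
    (hf : Continuous fun q : Vec n × Vec d => P.f q.1 q.2)
    (hL2 : MemLp (deriv P.zbar) 2 (volume.restrict (Set.Icc 0 P.T)))
    {z : ℕ → State n d} (hz : P.IsOptimal z)
    (hφL : LocallyLipschitzAround P.φ (xc (z P.k)))
    (hℓL : ∀ j < P.k, LocallyLipschitzAround (P.ℓ (P.t j)) (pair (z j) (P.vel z j)))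
    (hnear : ∀ j < P.k, ‖z j - P.zbar (P.t j)‖ < P.ε / 2)
    (hvel : P.velocityGap z < P.ε / 2) (hu : ‖uc (P.vel z 0)‖ ≤ P.μ)
    (hvar : P.uVariation z ≤ P.μ) :
    ∃ (lam : ℝ) (ϑ : Vec n) (w v : ℕ → State n d) (η : ℕ → EProd (State n d) (Vec n))
      (α : Fin m → ℝ) (ξ : ℕ → ℝ) (p : ℕ → State n d),
      0 ≤ lam ∧
      (lam = 0 → (∀ i, α i = 0) → (∀ j ≤ P.k, ξ j = 0) → ∃ j < P.k, η j ≠ 0) ∧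
      ϑ ∈ subdiff P.φ (xc (z P.k)) ∧
      (∀ j < P.k, pair (w j) (v j) ∈ subdiff (P.ℓ (P.t j)) (pair (z j) (P.vel z j))) ∧
      (∀ j < P.k, η j ∈ limitingNormalCone (pair (z j) (-xc (P.vel z j))) (gph P.F)) ∧
      (∀ i, α i ∈ limitingNormalCone ⟪P.gen i, xc (z P.k) - uc (z P.k)⟫ (Set.Iic 0)) ∧
      ξ 0 = 0 ∧
      (∀ j < P.k, ξ (j + 1) ∈ limitingNormalCone (‖uc (z (j + 1))‖ ^ 2)
        (Set.Icc (P.normSqLower (j + 1)) (P.normSqUpper (j + 1)))) ∧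
      (∀ j < P.k, p (j + 1) = P.h⁻¹ • ((lam * P.h) • v j + lam • P.θ z j
        - triple (η j).snd 0 0)) ∧
      (∀ j < P.k, p (j + 1) - p j = ((lam * P.h) • w j + (η j).fst)
        + triple ((lam * P.h) • P.χ z j) ((2 * ξ j) • uc (z j)) 0) ∧
      p P.k + triple ((lam * P.h) • P.χ z P.k) ((2 * ξ P.k) • uc (z P.k)) 0
        + triple (lam • ϑ + ∑ i, α i • P.gen i) (-∑ i, α i • P.gen i) 0 = 0 := by
  have hh := h_pos hT hk
  obtain ⟨lam, ϑ, s, η, α, ξ, hlam, hsum, hϑ, hs, hη, hα, hξ, hstat⟩ :=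
    hz.exists_stationary_multipliers hT hk hr hb hf hL2 hφL hℓL hnear hvel hu hvar
  -- The multiplier with index `j` belongs to node `j + 1`; the fixed node 0 receives 0.
  let ξ' : ℕ → ℝ := fun j => Nat.casesOn j 0 (extendZero ξ)
  -- `a`, `b`, `c` and `q` collect the coefficients of `z j`, of the velocity at `j`, of the
  -- remaining terms at single nodes, and of the terminal terms.
  let a : ℕ → State n d := fun j => (lam * P.h) • (extendZero s j).fst + (extendZero η j).fst
  let b : ℕ → State n d := fun j => (lam * P.h) • (extendZero s j).snd + lam • P.θ z j
    - triple (extendZero η j).snd 0 0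
  let c : ℕ → State n d := fun j =>
    triple ((lam * P.h) • P.χ z j) ((2 * ξ' j) • uc (z j)) 0
  let q : State n d := triple (lam • ϑ + ∑ i, α i • P.gen i) (-∑ i, α i • P.gen i) 0
  obtain ⟨hnode, hlast⟩ := node_equations_of_stationary (k := P.k) (h := P.h) (a := a) (b := b)
    (c := c) (q := q) (by
    intro δ
    have hab : ∀ j, ⟪a j, shift P.k j δ⟫ + ⟪b j, P.velShift j δ⟫
        = lam * (P.h * ⟪extendZero s j, pair (shift P.k j δ) (P.velShift j δ)⟫
            + ⟪P.θ z j, P.velShift j δ⟫)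
          + ⟪extendZero η j, pair (shift P.k j δ) (-xc (P.velShift j δ))⟫ := by
      intro j
      simp only [a, b, inner_pair, inner_add_left, inner_sub_left, real_inner_smul_left,
        inner_triple, inner_zero_left, inner_neg_right]
      ring
    have hc : ∀ j, ⟪c (j + 1), shift P.k (j + 1) δ⟫
        = lam * (P.h * ⟪P.χ z (j + 1), xc (shift P.k (j + 1) δ)⟫)
          + extendZero ξ j * (2 * ⟪uc (z (j + 1)), uc (shift P.k (j + 1) δ)⟫) := by
      intro j
      simp only [c, ξ', inner_triple, real_inner_smul_left, inner_zero_left]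
      ring
    have hq : ⟪q, shift P.k P.k δ⟫ = lam * ⟪ϑ, xc (shift P.k P.k δ)⟫
        + ∑ i, α i * ⟪P.gen i, xc (shift P.k P.k δ) - uc (shift P.k P.k δ)⟫ := by
      simp only [q, inner_triple, inner_add_left, inner_neg_left, sum_inner,
        real_inner_smul_left, inner_zero_left, inner_sub_right, mul_sub, Finset.sum_sub_distrib]
      ring
    -- Since node 0 is fixed, the initial velocity varies only through node 1; this turns its
    -- penalty into a node term and explains the factor `2 / h ^ 2` in `χ`.
    have hχ : ∑ j ∈ Finset.range P.k, P.h * ⟪P.χ z (j + 1), xc (shift P.k (j + 1) δ)⟫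
        = 2 * ⟪xc (P.vel z 0) - P.xdot0, xc (P.velShift 0 δ)⟫ := by
      rw [Finset.sum_eq_single 0 (fun j _ hj => by simp [χ, hj]) (fun h => absurd
        (Finset.mem_range.2 hk) h)]
      have : xc (P.velShift 0 δ) = P.h⁻¹ • xc (shift P.k (0 + 1) δ) := by
        change P.h⁻¹ • (xc (shift P.k (0 + 1) δ) - 0) = _
        rw [sub_zero]
      rw [this, χ, if_pos rfl, real_inner_smul_left, real_inner_smul_right]
      field_simp
    refine Eq.trans ?_ (hstat δ)
    change ∑ j ∈ Finset.range P.k, (⟪a j, shift P.k j δ⟫ + ⟪b j, P.velShift j δ⟫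
      + ⟪c (j + 1), shift P.k (j + 1) δ⟫) + ⟪q, shift P.k P.k δ⟫ = _
    simp only [hab, hc, hq, ← hχ, Finset.sum_add_distrib, ← Finset.mul_sum]
    simp only [Finset.sum_range, extendZero_val]
    ring)
  -- No stationarity condition exists at node 0, so `p 0` is defined by requiring the recursion at
  -- `j = 0`.
  let p : ℕ → State n d := fun j => Nat.casesOn j (P.h⁻¹ • b 0 - (a 0 + c 0)) fun i => P.h⁻¹ • b i
  refine ⟨lam, ϑ, fun j => (extendZero s j).fst, fun j => (extendZero s j).snd, extendZero η, α,
    ξ', p, hlam, fun h0 hα0 hξ0 => ?_, hϑ, fun j hj => ?_, fun j hj => ?_, hα, rfl,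
    fun j hj => ?_, fun j _ => rfl, fun j hj => ?_, ?_⟩
  · by_contra! hη0
    have h1 : ∀ j, η j = 0 := fun j => by
      have := hη0 j j.2
      rwa [extendZero_val] at this
    have h2 : ∀ j, ξ j = 0 := fun j => by
      have := hξ0 (j + 1) j.2
      change extendZero ξ j = 0 at this
      rwa [extendZero_val] at this
    simp [h0, hα0, h1, h2] at hsum
  · change extendZero s j ∈ _
    rw [extendZero_of_lt s hj]
    exact hs ⟨j, hj⟩
  · rw [extendZero_of_lt η hj]
    exact hη ⟨j, hj⟩
  · change extendZero ξ j ∈ _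
    rw [extendZero_of_lt ξ hj]
    exact hξ ⟨j, hj⟩
  · cases j with
    | zero => exact sub_sub_cancel (P.h⁻¹ • b 0) (a 0 + c 0)
    | succ i => exact hnode i hj
  · obtain ⟨i, hi⟩ : ∃ i, i + 1 = P.k := ⟨P.k - 1, by omega⟩
    have h1 := hlast i hi
    have h2 : p P.k = P.h⁻¹ • b i := by rw [← hi]
    rw [h2]
    exact h1

end Data

end SweepingControl

/-! ### The necessary optimality conditions -/

open SweepingControl Data

theorem mainTheorem4 {n m d : ℕ} (P : SweepingControl.Data n m d)
    -- parameters
    (hT : 0 < P.T) (hr : 0 < P.r) (hτ : 0 ≤ P.τ) (hτ' : P.τ ≤ min P.r P.T)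
    (hk : 1 ≤ P.k) (hε : 0 < P.ε) (hεk : 0 ≤ P.εk)
    -- the perturbation mapping
    (hf : Continuous fun q : SweepingControl.Vec n × SweepingControl.Vec d => P.f q.1 q.2)
    -- the costs take values in `(-∞, ∞]`
    (hφ : ∀ x, P.φ x ≠ ⊥) (hℓ : ∀ t q, P.ℓ t q ≠ ⊥)
    -- the reference arc is of class `W^{1,2}` and its `x`-part has a right derivative at `0`
    (hac : AbsolutelyContinuousOnInterval P.zbar 0 P.T)
    (hL2 : MeasureTheory.MemLp (deriv P.zbar) 2
      (MeasureTheory.volume.restrict (Set.Icc 0 P.T)))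
    (hx0 : DifferentiableWithinAt ℝ (fun s => SweepingControl.xc (P.zbar s)) (Set.Ici 0) 0)
    -- an optimal solution
    (z : ℕ → SweepingControl.State n d) (hz : P.IsOptimal z)
    -- the costs are locally Lipschitz around the points in question
    (hφL : SweepingControl.LocallyLipschitzAround P.φ (SweepingControl.xc (z P.k)))
    (hℓL : ∀ j < P.k, SweepingControl.LocallyLipschitzAround (P.ℓ (P.t j))
      (SweepingControl.pair (z j) (P.vel z j)))
    -- the localization constraints are inactive and the variation penalties vanish
    (hnear : ∀ j < P.k, ‖z j - P.zbar (P.t j)‖ < P.ε / 2)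
    (hvel : P.velocityGap z < P.ε / 2)
    (hu : ‖SweepingControl.uc (P.vel z 0)‖ ≤ P.μ)
    (hvar : P.uVariation z ≤ P.μ) :
    ∃ (lam : ℝ) (α : SweepingControl.Vec m) (ξ : ℕ → ℝ)
      (p w v : ℕ → SweepingControl.State n d),
      0 ≤ lam ∧ (∀ i, 0 ≤ α i) ∧
      -- nontriviality
      lam + ‖α‖ + Real.sqrt (∑ j ∈ Finset.range (P.k + 1), ξ j ^ 2)
        + ∑ j ∈ Finset.range P.k, ‖SweepingControl.xc (p j)‖
        + ‖SweepingControl.uc (p 0)‖ + ‖SweepingControl.ac (p 0)‖ ≠ 0 ∧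
      -- complementary slackness
      (∀ i, α i * inner ℝ (P.gen i)
        (SweepingControl.xc (z P.k) - SweepingControl.uc (z P.k)) = 0) ∧
      -- sign conditions for the norm constraints
      (∀ j ≤ P.k, ¬ P.MiddleNode j →
        ∀ ν ∈ Set.Icc (P.r - P.τ - P.εk) (P.r + P.τ + P.εk),
          ξ j * (ν - ‖SweepingControl.uc (z j)‖) ≤ 0) ∧
      -- transversality (`P.χ z P.k` is zero unless `P.k = 1`)
      (∃ ϑ ∈ SweepingControl.subdiff P.φ (SweepingControl.xc (z P.k)),
        -SweepingControl.xc (p P.k)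
          = lam • (ϑ + P.h • P.χ z P.k) + ∑ i, α i • P.gen i) ∧
      SweepingControl.uc (p P.k)
        = ∑ i, α i • P.gen i - (2 * ξ P.k) • SweepingControl.uc (z P.k) ∧
      SweepingControl.ac (p P.k) = 0 ∧
      -- subgradients of the running cost
      (∀ j < P.k, SweepingControl.pair (w j) (v j) ∈
        SweepingControl.subdiff (P.ℓ (P.t j)) (SweepingControl.pair (z j) (P.vel z j))) ∧
      -- adjoint relations for the control components
      (∀ j < P.k,
        SweepingControl.uc (p (j + 1))
          = lam • (SweepingControl.uc (v j) + P.h⁻¹ • SweepingControl.uc (P.θ z j)) ∧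
        SweepingControl.ac (p (j + 1))
          = lam • (SweepingControl.ac (v j) + P.h⁻¹ • SweepingControl.ac (P.θ z j))) ∧
      -- discrete Euler-Lagrange inclusion
      (∀ j < P.k,
        SweepingControl.pair
          (SweepingControl.triple
            (P.h⁻¹ • (SweepingControl.xc (p (j + 1)) - SweepingControl.xc (p j))
              - lam • SweepingControl.xc (w j) - lam • P.χ z j)
            (P.h⁻¹ • (SweepingControl.uc (p (j + 1)) - SweepingControl.uc (p j))
              - lam • SweepingControl.uc (w j)
              - (2 / P.h * ξ j) • SweepingControl.uc (z j))
            (P.h⁻¹ • (SweepingControl.ac (p (j + 1)) - SweepingControl.ac (p j))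
              - lam • SweepingControl.ac (w j)))
          (lam • (SweepingControl.xc (v j) + P.h⁻¹ • SweepingControl.xc (P.θ z j))
            - SweepingControl.xc (p (j + 1)))
        ∈ SweepingControl.limitingNormalCone
            (SweepingControl.pair (z j) (-SweepingControl.xc (P.vel z j)))
            (SweepingControl.gph P.F)) := by

  
  have hh := h_pos hT hk
  have hτr := (le_min_iff.1 hτ').1
  have hb : 0 ≤ P.r + P.τ + P.εk := by linarith
  obtain ⟨lam, ϑ, w, v, η, α, ξ, p, hlam, hne, hϑ, hs, hη, hα, hξ0, hξ, hp, hEL, hlast⟩ :=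
    hz.exists_node_multipliers hT hk hr hb hf hL2 hφL hℓL hnear hvel hu hvar
  have hαs := fun i =>
    nonneg_and_mul_eq_zero_of_mem_limitingNormalCone_Iic (hz.1.terminal i) (hα i)
  have hpx : ∀ j < P.k, xc (p (j + 1)) = lam • (xc (v j) + P.h⁻¹ • xc (P.θ z j))
      - P.h⁻¹ • (η j).snd := by
    intro j hj
    rw [hp j hj]
    change P.h⁻¹ • ((lam * P.h) • xc (v j) + lam • xc (P.θ z j) - (η j).snd) = _
    match_scalars <;> field_simp
  have hpu : ∀ j < P.k, uc (p (j + 1)) = lam • (uc (v j) + P.h⁻¹ • uc (P.θ z j)) := by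
    intro j hj
    rw [hp j hj]
    change P.h⁻¹ • ((lam * P.h) • uc (v j) + lam • uc (P.θ z j) - 0) = _
    match_scalars <;> field_simp
  have hpa : ∀ j < P.k, ac (p (j + 1)) = lam • (ac (v j) + P.h⁻¹ • ac (P.θ z j)) := by
    intro j hj
    rw [hp j hj]
    change P.h⁻¹ • ((lam * P.h) • ac (v j) + lam • ac (P.θ z j) - 0) = _
    match_scalars <;> field_simp
  have hlx : xc (p P.k) + (lam * P.h) • P.χ z P.k + (lam • ϑ + ∑ i, α i • P.gen i) = 0 :=
    congrArg xc hlast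
  have hlu : uc (p P.k) + (2 * ξ P.k) • uc (z P.k) + -∑ i, α i • P.gen i = 0 :=
    congrArg uc hlast
  have hla : ac (p P.k) + 0 + 0 = 0 := congrArg ac hlast
  -- The Euler–Lagrange vector equals `P.h⁻¹ • η j`. This gives the inclusion, and also recovers `η
  -- j` from the other multipliers for nontriviality.
  have hincl : ∀ j < P.k, pair (triple
      (P.h⁻¹ • (xc (p (j + 1)) - xc (p j)) - lam • xc (w j) - lam • P.χ z j)
      (P.h⁻¹ • (uc (p (j + 1)) - uc (p j)) - lam • uc (w j) - (2 / P.h * ξ j) • uc (z j))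
      (P.h⁻¹ • (ac (p (j + 1)) - ac (p j)) - lam • ac (w j)))
      (lam • (xc (v j) + P.h⁻¹ • xc (P.θ z j)) - xc (p (j + 1))) = P.h⁻¹ • η j := by
    intro j hj
    have hx : xc (p (j + 1)) - xc (p j) = (lam * P.h) • xc (w j) + xc (η j).fst
      + (lam * P.h) • P.χ z j := congrArg xc (hEL j hj)
    have hu : uc (p (j + 1)) - uc (p j) = (lam * P.h) • uc (w j) + uc (η j).fst
      + (2 * ξ j) • uc (z j) := congrArg uc (hEL j hj)
    have ha : ac (p (j + 1)) - ac (p j) = (lam * P.h) • ac (w j) + ac (η j).fst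
      + 0 := congrArg ac (hEL j hj)
    refine (WithLp.equiv 2 _).injective (Prod.ext (State.ext ?_ ?_ ?_) ?_)
    · change P.h⁻¹ • (xc (p (j + 1)) - xc (p j)) - lam • xc (w j) - lam • P.χ z j
        = P.h⁻¹ • xc (η j).fst
      rw [hx]
      match_scalars <;> field_simp <;> ring
    · change P.h⁻¹ • (uc (p (j + 1)) - uc (p j)) - lam • uc (w j) - (2 / P.h * ξ j) • uc (z j)
        = P.h⁻¹ • uc (η j).fst
      rw [hu]
      match_scalars <;> field_simp <;> ring
    · change P.h⁻¹ • (ac (p (j + 1)) - ac (p j)) - lam • ac (w j) = P.h⁻¹ • ac (η j).fst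
      rw [ha]
      match_scalars <;> field_simp <;> ring
    · change lam • (xc (v j) + P.h⁻¹ • xc (P.θ z j)) - xc (p (j + 1)) = P.h⁻¹ • (η j).snd
      rw [hpx j hj, sub_sub_cancel]
  refine ⟨lam, WithLp.toLp 2 α, ξ, p, w, v, hlam, fun i => (hαs i).1, fun hzero => ?_,
    fun i => (hαs i).2, fun j hj hm ν hν => ?_, ⟨ϑ, hϑ, ?_⟩, ?_, by simpa using hla, hs,
    fun j hj => ⟨hpu j hj, hpa j hj⟩, fun j hj => ?_⟩
  · have n1 := norm_nonneg (WithLp.toLp 2 α : Vec m)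
    have n2 := Real.sqrt_nonneg (∑ j ∈ Finset.range (P.k + 1), ξ j ^ 2)
    have n3 : ∀ j ∈ Finset.range P.k, 0 ≤ ‖xc (p j)‖ := fun j _ => norm_nonneg _
    have n4 := Finset.sum_nonneg n3
    have n5 := norm_nonneg (uc (p 0))
    have n6 := norm_nonneg (ac (p 0))
    have hl0 : lam = 0 := by linarith
    have hα0 : ∀ i, α i = 0 := fun i => congrArg (fun a : Vec m => a i)
      (norm_eq_zero.1 (by linarith : ‖(WithLp.toLp 2 α : Vec m)‖ = 0))
    have hξs : ∑ j ∈ Finset.range (P.k + 1), ξ j ^ 2 = 0 :=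
      (Real.sqrt_eq_zero (by positivity)).1 (by linarith)
    have hξ0 : ∀ j ≤ P.k, ξ j = 0 := fun j hj => pow_eq_zero_iff two_ne_zero |>.1
      ((Finset.sum_eq_zero_iff_of_nonneg fun j _ => sq_nonneg (ξ j)).1 hξs j
        (Finset.mem_range.2 (by omega)))
    -- The nontriviality sum stops at `k - 1`; `xc (p P.k)` vanishes by transversality. Below, the
    -- control components at positive nodes vanish because they are multiples of `lam`.
    have hx0 : ∀ j ≤ P.k, xc (p j) = 0 := fun j hj => by
      rcases hj.eq_or_lt with rfl | hj
      · simpa [hl0, hα0] using hlx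
      · exact norm_eq_zero.1 ((Finset.sum_eq_zero_iff_of_nonneg n3).1 (by linarith) j
          (Finset.mem_range.2 hj))
    have hu0 : ∀ j ≤ P.k, uc (p j) = 0 := fun j hj => by
      cases j with
      | zero => exact norm_eq_zero.1 (by linarith)
      | succ j => rw [hpu j hj, hl0, zero_smul]
    have ha0 : ∀ j ≤ P.k, ac (p j) = 0 := fun j hj => by
      cases j with
      | zero => exact norm_eq_zero.1 (by linarith)
      | succ j => rw [hpa j hj, hl0, zero_smul]
    obtain ⟨j, hj, hηj⟩ := hne hl0 hα0 hξ0
    have h1 := hincl j hj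
    rw [hx0 j hj.le, hx0 (j + 1) hj, hu0 j hj.le, hu0 (j + 1) hj, ha0 j hj.le, ha0 (j + 1) hj,
      hl0, hξ0 j hj.le] at h1
    simp only [sub_zero, smul_zero, zero_smul, mul_zero] at h1
    exact hηj ((smul_eq_zero.1 h1.symm).resolve_left (inv_pos.2 hh).ne')
  · cases j with
    | zero => simp [hξ0]
    | succ j =>
      refine mul_sub_norm_le_zero hm (fun ν' hν' => ?_) hν
      have := inner_le_zero_of_mem_limitingNormalCone (convex_Icc _ _)
        (hξ j hj) hν'
      simpa [mul_comm] using this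
  · rw [← sub_eq_zero]
    refine Eq.trans ?_ (neg_eq_zero.2 hlx)
    module
  · rw [← sub_eq_zero]
    refine Eq.trans ?_ hlu
    module
  · rw [hincl j hj]
    exact smul_mem_limitingNormalCone (hη j hj) (inv_pos.2 hh).le
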